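/- Let $n\ge 1$ and let $H_n$ be the Heisenberg group $\mathbb{R}^{n}\times\mathbb{R}^n\times\mathbb{R}$ with the law $(x,y,z)(x',y',z')=(x+x',\,y+y',\,z+z'+\tfrac12\sum_i(x_iy_i'-y_ix_i'))$, let $\mathfrak h_n$ be its Lie algebra with the basis $X_1,\dots,X_n,Y_1,\dots,Y_n,Z$ of coordinate vectors at the identity (so $[X_i,Y_i]=Z$ and the other brackets vanish), and identify $\mathfrak h_n$ with $H_n$ by the exponential map. Let $\mathfrak v_0=\mathrm{span}(X_i,Y_i)$, let $P:\mathfrak h_n\to\mathfrak v_0$ be the projection along $Z$, and let $\omega:\mathfrak h_n\to\mathbb R$ be the linear form with kernel $\mathfrak v_0$ and $\omega(Z)=1$. Let $\boldsymbol r=(r_1,\dots,r_n)$ be positive integers with $r_1\mid r_2\mid\cdots\mid r_n$ and let $\Gamma_{\boldsymbol r}<H_n$ be the lattice generated by $r_1X_1,\dots,r_nX_n,Y_1,\dots,Y_n,Z$. For $A\in GL_{2n+1}(\mathbb R)$ let $\langle\cdot,\cdot\rangle_A$ be the inner product on $\mathfrak h_n$ for which the images under $A$ of the basis vectors are orthonormal,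 $\|\cdot\|_A$ its norm, and $g_A$ the corresponding left-invariant Riemannian metric on $H_n$ and the induced one on $\Gamma_{\boldsymbol r}\backslash H_n$ (every left-invariant Riemannian metric is of this form). A matrix $B=\begin{pmatrix}\tilde B&0\\0&\rho_B\end{pmatrix}$ of the form $B=QAR$, with $Q$ the differential at the identity of an inner automorphism of $H_n$ and $R\in O(2n+1)$, is called a weak canonical form of $A$. For such a $B$ let $j_B:\mathfrak v_0\to\mathfrak v_0$ be defined by $\langle j_B U,W\rangle_B=\omega([U,W])$, and let $0<d_1(B)\le\dots\le d_n(B)$ be the numbers such that $\pm\sqrt{-1}\,d_1(B),\dots,\pm\sqrt{-1}\,d_n(B)$ are the eigenvalues of $j_B$, with multiplicity. **Proposition.** Let $D,V,K>0$ and put $$C_2=(4nD)^{-2n},\quad C_+=\frac{\prod_{i=1}^n r_i}{V\,C_2},\quad C_3=\sqrt{2K}\,C_+,\quad C_-=\frac{C_2^{1/n}}{\sqrt{2K}},\quad C_1=C_3^{-n}(4nD)^{-2n+1}.$$ These constants are positive, and for every $A\in GL_{2n+1}(\mathbb R)$ such that $$\mathrm{diam}(\Gamma_{\boldsymbol r}\backslash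 H_n,g_A)\le D,\qquad \mathrm{vol}(\Gamma_{\boldsymbol r}\backslash H_n,g_A)\ge V,\qquad \mathrm{Ric}_{g_A}\ge -K,$$ a weak canonical form of $A$ exists, and every weak canonical form $B$ of $A$ satisfies - (A-1) $\|U\|_B\ge C_1$ for every nonzero $U\in P(\Gamma_{\boldsymbol r})$, - (A-2) $|\det\tilde B|\ge C_2$, - (A-3) $d_n(B)\le C_3$, - (A-4) $C_-\le|\rho_B|\le C_+$. -/

import Mathlib

open MeasureTheory
open scoped Manifold ENNReal

noncomputable section

/-! ### Riemannian metrics in a global chart `ℝ^ι`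

`g x` is the Gram matrix of the metric at `x` in the coordinate frame. -/

/-- The partial derivative `∂_i f` at `x`. -/
def pderiv {ι : Type*} [Fintype ι] [DecidableEq ι] (i : ι) (f : (ι → ℝ) → ℝ) (x : ι → ℝ) : ℝ :=
  fderiv ℝ f x (Pi.single i 1)

/-- The Christoffel symbol `Γ^k_{ij} = ½ ∑_l g^{kl} (∂_i g_{jl} + ∂_j g_{il} - ∂_l g_{ij})` of the
Levi-Civita connection. -/
def christoffel {ι : Type*} [Fintype ι] [DecidableEq ι] (g : (ι → ℝ) → Matrix ι ι ℝ)
    (k i j : ι) (x : ι → ℝ) : ℝ :=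
  (1 / 2) * ∑ l, (g x)⁻¹ k l *
    (pderiv i (fun y => g y j l) x + pderiv j (fun y => g y i l) x
      - pderiv l (fun y => g y i j) x)

/-- The components of the Ricci tensor,
`Ric_{jk} = ∑_i (∂_i Γ^i_{jk} - ∂_j Γ^i_{ik} + ∑_l (Γ^i_{il} Γ^l_{jk} - Γ^i_{jl} Γ^l_{ik}))`. -/
def ricciCoord {ι : Type*} [Fintype ι] [DecidableEq ι] (g : (ι → ℝ) → Matrix ι ι ℝ)
    (j k : ι) (x : ι → ℝ) : ℝ :=
  ∑ i, (pderiv i (christoffel g i j k) x - pderiv j (christoffel g i i k) x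
    + ∑ l, (christoffel g i i l x * christoffel g l j k x
      - christoffel g i j l x * christoffel g l i k x))

/-- The Ricci tensor `Ric_x(u, v)`. -/
def ricci {ι : Type*} [Fintype ι] [DecidableEq ι] (g : (ι → ℝ) → Matrix ι ι ℝ)
    (x u v : ι → ℝ) : ℝ :=
  ∑ j, ∑ k, ricciCoord g j k x * u j * v k

/-! ### The Heisenberg group -/

/-- The index set of the basis `X_1, …, X_n, Y_1, …, Y_n` of `𝔳₀`. -/
abbrev HorIdx (n : ℕ) : Type := Fin n ⊕ Fin n

/-- The index set of the basis `X_1, …, X_n, Y_1, …, Y_n, Z` of `𝔥_n`. -/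
abbrev HeisIdx (n : ℕ) : Type := HorIdx n ⊕ Unit

/-- The Heisenberg group `H_n`, in the coordinates `(x_1, …, x_n, y_1, …, y_n, z)`. These are
exponential coordinates: the same type serves as the Lie algebra `𝔥_n` with its basis
`X_1, …, X_n, Y_1, …, Y_n, Z`, as well as for the tangent spaces in the coordinate frame.
The vector space structure is that of `𝔥_n`, the multiplication is the group law of `H_n`. -/
def Heis (n : ℕ) : Type := HeisIdx n → ℝ

namespace Heis

variable {n : ℕ}

instance : NormedAddCommGroup (Heis n) := inferInstanceAs (NormedAddCommGroup (HeisIdx n → ℝ))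

instance : NormedSpace ℝ (Heis n) := inferInstanceAs (NormedSpace ℝ (HeisIdx n → ℝ))

instance : MeasureSpace (Heis n) := inferInstanceAs (MeasureSpace (HeisIdx n → ℝ))

/-- The projection `P : 𝔥_n → 𝔳₀` (equivalently, from `H_n`, through the logarithm). -/
def hor (x : Heis n) : HorIdx n → ℝ := fun a => x (Sum.inl a)

/-- `symp u v = ∑ i, (u_{x_i} v_{y_i} - u_{y_i} v_{x_i})`. It is the imaginary part of the
Hermitian product on `ℂ^n`, and `[u, v] = symp u v • Z`, that is `symp u v = ω([u, v])`, for
`u, v ∈ 𝔳₀`. -/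
def symp (u v : HorIdx n → ℝ) : ℝ :=
  ∑ i, (u (Sum.inl i) * v (Sum.inr i) - u (Sum.inr i) * v (Sum.inl i))

/-- The group law `(x₁, z₁) (x₂, z₂) = (x₁ + x₂, z₁ + z₂ + ½ Im (x₁ · x₂))`. -/
instance : Mul (Heis n) :=
  ⟨fun x y => Sum.elim (fun a => x (Sum.inl a) + y (Sum.inl a))
    (fun c => x (Sum.inr c) + y (Sum.inr c) + (1 / 2) * symp (hor x) (hor y))⟩

instance : One (Heis n) := ⟨fun _ => 0⟩

instance : Inv (Heis n) := ⟨fun x a => -x a⟩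

theorem mul_inl (x y : Heis n) (a : HorIdx n) :
    (x * y) (Sum.inl a) = x (Sum.inl a) + y (Sum.inl a) := rfl

theorem mul_inr (x y : Heis n) (c : Unit) :
    (x * y) (Sum.inr c) = x (Sum.inr c) + y (Sum.inr c) + (1 / 2) * symp (hor x) (hor y) := rfl

theorem one_apply (a : HeisIdx n) : (1 : Heis n) a = 0 := rfl

theorem inv_apply (x : Heis n) (a : HeisIdx n) : (x⁻¹) a = -x a := rfl

instance : Group (Heis n) :=
  Group.ofLeftAxioms
    (by
      intro x y z
      funext a
      rcases a with a | c
      · simp only [mul_inl, add_assoc]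
      · have h1 : symp (hor (x * y)) (hor z) = symp (hor x) (hor z) + symp (hor y) (hor z) := by
          simp only [symp, hor, mul_inl, ← Finset.sum_add_distrib]
          exact Finset.sum_congr rfl fun i _ => by ring
        have h2 : symp (hor x) (hor (y * z)) = symp (hor x) (hor y) + symp (hor x) (hor z) := by
          simp only [symp, hor, mul_inl, ← Finset.sum_add_distrib]
          exact Finset.sum_congr rfl fun i _ => by ring
        simp only [mul_inr, h1, h2]
        ring)
    (by
      intro x
      funext a
      rcases a with a | c
      · simp only [mul_inl, one_apply, zero_add]
      · simp [mul_inr, one_apply, symp, hor])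
    (by
      intro x
      funext a
      rcases a with a | c
      · simp only [mul_inl, inv_apply, one_apply, neg_add_cancel]
      · simp only [mul_inr, inv_apply, one_apply, symp, hor]
        rw [Finset.sum_eq_zero fun i _ => by ring]
        ring)

/-- The vector of the basis `X_1, …, X_n, Y_1, …, Y_n, Z` with index `a`. -/
def basisVec (a : HeisIdx n) : Heis n := (Pi.single a 1 : HeisIdx n → ℝ)

/-- The set `D_n` of `n`-tuples of positive integers with `r_1 ∣ r_2 ∣ ⋯ ∣ r_n`. -/
def divisorChains (n : ℕ) : Set (Fin n → ℕ) :=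
  {r | (∀ i, 0 < r i) ∧ ∀ i j, i ≤ j → r i ∣ r j}

/-- The lattice `Γ_r`, generated by `r_1 X_1, …, r_n X_n, Y_1, …, Y_n, Z`. -/
def lattice (r : Fin n → ℕ) : Subgroup (Heis n) :=
  Subgroup.closure
    (Set.range (fun i => (r i : ℝ) • basisVec (Sum.inl (Sum.inl i))) ∪
      Set.range (fun i => basisVec (Sum.inl (Sum.inr i))) ∪ {basisVec (Sum.inr ())})

/-! ### Left-invariant metrics -/

/-- The inner product `⟨·,·⟩_A` on `𝔥_n` for which the images under the invertible matrix `A` of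
the basis vectors `X_1, …, X_n, Y_1, …, Y_n, Z` are orthonormal. -/
def innerA (A : Matrix (HeisIdx n) (HeisIdx n) ℝ) (u v : Heis n) : ℝ :=
  (A⁻¹.mulVec u) ⬝ᵥ (A⁻¹.mulVec v)

/-- The left-invariant Riemannian metric `g_A` on `H_n` with value `⟨·,·⟩_A` at the identity:
`g_A(u, v) = ⟨(L_x)_*⁻¹ u, (L_x)_*⁻¹ v⟩_A` for tangent vectors `u, v` at `x`. -/
def metric (A : Matrix (HeisIdx n) (HeisIdx n) ℝ) (x u v : Heis n) : ℝ :=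
  innerA A (fderiv ℝ (fun h : Heis n => x⁻¹ * h) x u) (fderiv ℝ (fun h : Heis n => x⁻¹ * h) x v)

/-- The Gram matrix of `g_A` at `x` in the coordinate frame. -/
def metricMatrix (A : Matrix (HeisIdx n) (HeisIdx n) ℝ) (x : HeisIdx n → ℝ) :
    Matrix (HeisIdx n) (HeisIdx n) ℝ :=
  Matrix.of fun i j => metric A x (basisVec i) (basisVec j)

/-- `Ric_{g_A} ≥ -K`, that is `Ric(u, u) ≥ -K g_A(u, u)` for all tangent vectors. As
`H_n → Γ \ H_n` is a local isometry, this is the same condition on `H_n` and on `Γ \ H_n`. -/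
def RicciGe (A : Matrix (HeisIdx n) (HeisIdx n) ℝ) (K : ℝ) : Prop :=
  ∀ x u : Heis n, -K * metric A x u u ≤ ricci (metricMatrix A) x u u

/-- The Riemannian distance of `g_A` on `H_n`: the infimum of the lengths of `C^1` curves. -/
def edistA (A : Matrix (HeisIdx n) (HeisIdx n) ℝ) (x y : Heis n) : ℝ≥0∞ :=
  @Manifold.riemannianEDist (Heis n) _ _ (Heis n) _ 𝓘(ℝ, Heis n) (Heis n) _ _
    (fun p => ⟨fun v => ENNReal.ofReal (Real.sqrt (metric A p v v))⟩) x y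

/-- The quotient `Γ_r \ H_n` of `H_n` by the left translations by `Γ_r`. -/
abbrev quot (r : Fin n → ℕ) : Type := MulAction.orbitRel.Quotient (lattice r) (Heis n)

/-- The Riemannian distance of the metric induced by `g_A` on `Γ_r \ H_n`. The curves from `p` to
`q` in the quotient lift to the curves in `H_n` from a point over `p` to a point over `q`, with
the same length. -/
def quotEDist (A : Matrix (HeisIdx n) (HeisIdx n) ℝ) (r : Fin n → ℕ) (p q : quot r) : ℝ≥0∞ :=
  ⨅ (x : Heis n) (y : Heis n) (_ : (Quotient.mk'' x : quot r) = p)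
    (_ : (Quotient.mk'' y : quot r) = q), edistA A x y

/-- The diameter of `(Γ_r \ H_n, g_A)`. -/
def diam (A : Matrix (HeisIdx n) (HeisIdx n) ℝ) (r : Fin n → ℕ) : ℝ≥0∞ :=
  ⨆ (p : quot r) (q : quot r), quotEDist A r p q

/-- The Riemannian measure of `g_A` on `H_n`, with density `√(det g_A)` in coordinates. -/
def riemMeasure (A : Matrix (HeisIdx n) (HeisIdx n) ℝ) : Measure (Heis n) :=
  (volume : Measure (Heis n)).withDensity
    fun x => ENNReal.ofReal (Real.sqrt (metricMatrix A x).det)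

/-- The total Riemannian volume of `(Γ_r \ H_n, g_A)`: the Riemannian measure of a fundamental
domain of `Γ_r` in `H_n`. -/
def vol (A : Matrix (HeisIdx n) (HeisIdx n) ℝ) (r : Fin n → ℕ) : ℝ≥0∞ :=
  covolume (lattice r) (Heis n) (riemMeasure A)

/-! ### Weak canonical form and the four conditions -/

/-- The matrix of the differential at the identity of the inner automorphism `h ↦ g h g⁻¹`. -/
def innMatrix (g : Heis n) : Matrix (HeisIdx n) (HeisIdx n) ℝ :=
  Matrix.of fun i j => (fderiv ℝ (fun h : Heis n => g * h * g⁻¹) 1 (basisVec j)) i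

/-- The matrix `diag(Ã, ρ)` of weak canonical form. -/
def weakCanonical (At : Matrix (HorIdx n) (HorIdx n) ℝ) (ρ : ℝ) :
    Matrix (HeisIdx n) (HeisIdx n) ℝ :=
  Matrix.fromBlocks At 0 0 (Matrix.of fun _ _ => ρ)

/-- The inclusion `𝔳₀ ⊂ 𝔥_n`. -/
def ofHor (u : HorIdx n → ℝ) : Heis n := Sum.elim u (fun _ => 0)

/-- `j : 𝔳₀ → 𝔳₀` is the operator `j_A`: `⟨j_A U, V⟩_A = ω([U, V])` for `U, V ∈ 𝔳₀`. -/
def IsJOperator (A : Matrix (HeisIdx n) (HeisIdx n) ℝ)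
    (j : (HorIdx n → ℝ) →ₗ[ℝ] (HorIdx n → ℝ)) : Prop :=
  ∀ U V : HorIdx n → ℝ, innerA A (ofHor (j U)) (ofHor V) = symp U V

open Polynomial in
/-- `d_1 ≤ ⋯ ≤ d_n` are the positive numbers `d_1(A), …, d_n(A)` such that
`±√-1 d_1, …, ±√-1 d_n` are the eigenvalues of `j_A`, with multiplicity. -/
def IsJSpectrum (A : Matrix (HeisIdx n) (HeisIdx n) ℝ) (d : Fin n → ℝ) : Prop :=
  (∀ k, 0 < d k) ∧ Monotone d ∧
    ∃ j : (HorIdx n → ℝ) →ₗ[ℝ] (HorIdx n → ℝ), IsJOperator A j ∧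
      j.charpoly.map (algebraMap ℝ ℂ) =
        ∏ k, ((X - C (Complex.I * (d k : ℂ))) * (X + C (Complex.I * (d k : ℂ))))

/-- The conditions (A-1) to (A-4) for the matrix `A = diag(Ã, ρ)` of weak canonical form.
The minimum in (A-1) is over the nonzero elements of the lattice `P(Γ_r)`; in (A-3), the numbers
`d_k` are determined by `A` and the bound for all of them is the bound for the largest, `d_n`. -/
structure BoldtConditions (r : Fin n → ℕ) (C₁ C₂ C₃ Cm Cp : ℝ)
    (At : Matrix (HorIdx n) (HorIdx n) ℝ) (ρ : ℝ) : Prop where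
  a1 : ∀ U ∈ hor '' (lattice r : Set (Heis n)), U ≠ 0 →
    C₁ ≤ Real.sqrt (innerA (weakCanonical At ρ) (ofHor U) (ofHor U))
  a2 : C₂ ≤ |At.det|
  a3 : ∃ d, IsJSpectrum (weakCanonical At ρ) d ∧ ∀ k, d k ≤ C₃
  a4 : Cm ≤ |ρ| ∧ |ρ| ≤ Cp

end Heis

end

noncomputable section

theorem Matrix.abs_det_of_mem_orthogonalGroup {ι : Type*} [Fintype ι] [DecidableEq ι]
    {R : Matrix ι ι ℝ} (hR : R ∈ Matrix.orthogonalGroup ι ℝ) : |R.det| = 1 := by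
  have := congrArg Matrix.det ((Matrix.mem_orthogonalGroup_iff _ _).1 hR)
  rw [Matrix.det_mul, Matrix.det_transpose, Matrix.det_one] at this
  exact (abs_eq (by norm_num)).2 (mul_self_eq_one_iff.1 this)

namespace Heis

variable {n : ℕ}

instance : FiniteDimensional ℝ (Heis n) :=
  inferInstanceAs (FiniteDimensional ℝ (HeisIdx n → ℝ))

instance : BorelSpace (Heis n) := inferInstanceAs (BorelSpace (HeisIdx n → ℝ))

/-! ### The symplectic form -/

/-- The matrix of the symplectic form `symp`. -/
def sympMatrix (n : ℕ) : Matrix (HorIdx n) (HorIdx n) ℝ := Matrix.fromBlocks 0 1 (-1) 0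

theorem symp_eq (u v : HorIdx n → ℝ) : symp u v = u ⬝ᵥ (sympMatrix n).mulVec v := by
  have h : v = Sum.elim (fun i => v (Sum.inl i)) (fun i => v (Sum.inr i)) := by
    ext (i | i) <;> rfl
  conv_rhs => rw [h]
  rw [sympMatrix, Matrix.fromBlocks_mulVec]
  simp [symp, dotProduct, Matrix.neg_mulVec, sub_eq_add_neg, Finset.sum_add_distrib]

theorem sympMatrix_transpose : (sympMatrix n).transpose = -sympMatrix n := by
  simp [sympMatrix, Matrix.fromBlocks_transpose, Matrix.fromBlocks_neg]

theorem sympMatrix_mul_transpose : sympMatrix n * (sympMatrix n).transpose = 1 := by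
  simp [sympMatrix, Matrix.fromBlocks_transpose, Matrix.fromBlocks_multiply]

theorem symp_add_left (u v w : HorIdx n → ℝ) : symp (u + v) w = symp u w + symp v w := by
  simp [symp_eq, add_dotProduct]

theorem symp_smul_left (t : ℝ) (u w : HorIdx n → ℝ) : symp (t • u) w = t * symp u w := by
  simp [symp_eq, smul_dotProduct]

theorem symp_neg_left (u w : HorIdx n → ℝ) : symp (-u) w = -symp u w := by
  simp [symp_eq]

theorem symp_neg_right (u w : HorIdx n → ℝ) : symp u (-w) = -symp u w := by
  simp [symp_eq, Matrix.mulVec_neg]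

theorem symp_swap (u v : HorIdx n → ℝ) : symp u v = -symp v u := by
  simp only [symp, ← Finset.sum_neg_distrib]
  exact Finset.sum_congr rfl fun i _ => by ring

theorem symp_self (u : HorIdx n → ℝ) : symp u u = 0 := by
  have := symp_swap u u; linarith

/-! ### Shears and the left-invariant metrics -/

/-- The matrix of the linear map `u ↦ u + symp a (hor u) • Z`. -/
def shear (a : HorIdx n → ℝ) : Matrix (HeisIdx n) (HeisIdx n) ℝ :=
  Matrix.fromBlocks 1 0 (Matrix.of fun _ b => symp a (Pi.single b 1)) 1

/-- The coordinate vector of an element of `Heis n`. -/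
def coord (u : Heis n) : HeisIdx n → ℝ := u

theorem coord_inl (u : Heis n) (b : HorIdx n) : coord u (Sum.inl b) = hor u b := rfl

theorem coord_eq (u : Heis n) : coord u = Sum.elim (hor u) (fun _ => u (Sum.inr ())) := by
  ext (i | i) <;> rfl

theorem shear_mulVec (a u : HorIdx n → ℝ) (t : ℝ) :
    (shear a).mulVec (Sum.elim u fun _ => t) = Sum.elim u fun _ => t + symp a u := by
  rw [shear, Matrix.fromBlocks_mulVec]
  ext (i | i)
  · simp
  · simp only [Sum.elim_comp_inl, Sum.elim_comp_inr, Sum.elim_inr, Pi.add_apply,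
      Matrix.one_mulVec]
    rw [add_comm]
    congr 1
    simp only [Matrix.mulVec, symp_eq, Matrix.of_apply, Matrix.dotProduct_mulVec,
      dotProduct_single, mul_one]

theorem shear_mulVec_inl (a : HorIdx n → ℝ) (u : Heis n) (b : HorIdx n) :
    (shear a).mulVec (coord u) (Sum.inl b) = u (Sum.inl b) := by
  rw [coord_eq, shear_mulVec]; rfl

theorem shear_mulVec_inr (a : HorIdx n → ℝ) (u : Heis n) (c : Unit) :
    (shear a).mulVec (coord u) (Sum.inr c) = u (Sum.inr c) + symp a (hor u) := by
  rw [coord_eq, shear_mulVec]; rfl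

theorem shear_mul_shear (a b : HorIdx n → ℝ) : shear a * shear b = shear (a + b) := by
  rw [shear, shear, shear, Matrix.fromBlocks_multiply]
  simp only [Matrix.mul_one, Matrix.mul_zero, add_zero, zero_add, Matrix.zero_mul, Matrix.one_mul]
  congr 1
  ext i j
  simp [symp_add_left]

theorem det_shear (a : HorIdx n → ℝ) : (shear a).det = 1 := by
  simp [shear]

theorem fderiv_of_affine (a : HorIdx n → ℝ) (x₀ : Heis n) (f : Heis n → Heis n)
    (hf : ∀ h, coord (f h) = coord x₀ + (shear a).mulVec (coord h)) (x v : Heis n) :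
    coord (fderiv ℝ f x v) = (shear a).mulVec (coord v) := by
  let T : Heis n →L[ℝ] Heis n :=
    LinearMap.toContinuousLinearMap (Matrix.mulVecLin (shear a) : (HeisIdx n → ℝ) →ₗ[ℝ] _)
  have h : f = fun h => x₀ + T h := funext hf
  rw [h, ((T.hasFDerivAt (x := x)).const_add x₀).fderiv]
  rfl

theorem coord_fderiv_leftTranslation (x y v : Heis n) :
    coord (fderiv ℝ (fun h : Heis n => x⁻¹ * h) y v) =
      (shear (-(1 / 2 : ℝ) • hor x)).mulVec (coord v) := by
  refine fderiv_of_affine _ x⁻¹ _ (fun h => ?_) y v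
  funext a
  rw [Pi.add_apply]
  rcases a with a | c
  · rw [shear_mulVec_inl]; rfl
  · rw [shear_mulVec_inr, symp_smul_left]
    change (x⁻¹ * h) (Sum.inr c) = x⁻¹ (Sum.inr c) + _
    rw [mul_inr, show hor x⁻¹ = -hor x from rfl, symp_neg_left]
    ring

theorem innMatrix_eq (g : Heis n) : innMatrix g = shear (hor g) := by
  ext i j
  have h := fderiv_of_affine (hor g) 0 (fun h : Heis n => g * h * g⁻¹) (fun h => ?_) 1 (basisVec j)
  · refine (congrFun h i).trans (congrFun (Matrix.mulVec_single_one _ _) i)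
  · funext a
    rw [Pi.add_apply, show coord (0 : Heis n) a = 0 from rfl, zero_add]
    rcases a with a | c
    · rw [shear_mulVec_inl]
      change (g * h * g⁻¹) (Sum.inl a) = _
      rw [mul_inl, mul_inl, inv_apply]; ring
    · rw [shear_mulVec_inr]
      change (g * h * g⁻¹) (Sum.inr c) = _
      rw [mul_inr, mul_inr, inv_apply, show hor g⁻¹ = -hor g from rfl,
        show hor (g * h) = hor g + hor h from rfl, symp_neg_right, symp_add_left, symp_self,
        symp_swap (hor h)]
      ring

theorem metric_eq (A : Matrix (HeisIdx n) (HeisIdx n) ℝ) (x u v : Heis n) :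
    metric A x u v = (A⁻¹ * shear (-(1 / 2 : ℝ) • hor x)).mulVec (coord u) ⬝ᵥ
      (A⁻¹ * shear (-(1 / 2 : ℝ) • hor x)).mulVec (coord v) := by
  rw [← Matrix.mulVec_mulVec, ← Matrix.mulVec_mulVec, ← coord_fderiv_leftTranslation x x,
    ← coord_fderiv_leftTranslation x x]
  rfl

theorem metricMatrix_eq (A : Matrix (HeisIdx n) (HeisIdx n) ℝ) (x : Heis n) :
    metricMatrix A x = (A⁻¹ * shear (-(1 / 2 : ℝ) • hor x)).transpose *
      (A⁻¹ * shear (-(1 / 2 : ℝ) • hor x)) := by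
  ext i j
  refine (metric_eq A x _ _).trans ?_
  set M := A⁻¹ * shear (-(1 / 2 : ℝ) • hor x)
  have h (i : HeisIdx n) : M.mulVec (coord (basisVec i)) = M.col i :=
    Matrix.mulVec_single_one _ _
  rw [h, h]
  rfl

theorem sqrt_det_metricMatrix (A : Matrix (HeisIdx n) (HeisIdx n) ℝ) (x : Heis n) :
    Real.sqrt (metricMatrix A x).det = |A.det|⁻¹ := by
  rw [metricMatrix_eq, Matrix.det_mul, Matrix.det_transpose, Matrix.det_mul, det_shear, mul_one,
    Matrix.det_nonsing_inv, Real.sqrt_mul_self_eq_abs, Ring.inverse_eq_inv', abs_inv]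

/-! ### Weak canonical forms -/

theorem weakCanonical_mulVec (M : Matrix (HorIdx n) (HorIdx n) ℝ) (ρ : ℝ) (u : HorIdx n → ℝ)
    (t : ℝ) : (weakCanonical M ρ).mulVec (Sum.elim u fun _ => t) =
      Sum.elim (M.mulVec u) (fun _ => ρ * t) := by
  rw [weakCanonical, Matrix.fromBlocks_mulVec]
  ext (i | i)
  · simp
  · simp [Matrix.mulVec, dotProduct]

theorem det_weakCanonical (M : Matrix (HorIdx n) (HorIdx n) ℝ) (ρ : ℝ) :
    (weakCanonical M ρ).det = M.det * ρ := by
  simp [weakCanonical]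

theorem weakCanonical_inv {M : Matrix (HorIdx n) (HorIdx n) ℝ} {ρ : ℝ}
    (hM : IsUnit M.det) (hρ : ρ ≠ 0) : (weakCanonical M ρ)⁻¹ = weakCanonical M⁻¹ ρ⁻¹ := by
  refine Matrix.inv_eq_right_inv ?_
  rw [weakCanonical, weakCanonical, Matrix.fromBlocks_multiply, ← Matrix.fromBlocks_one]
  congr 1
  · simp [Matrix.mul_nonsing_inv _ hM]
  · simp
  · simp
  · ext i j
    simp [Matrix.mul_apply, hρ]

theorem innerA_weakCanonical_ofHor {M : Matrix (HorIdx n) (HorIdx n) ℝ} {ρ : ℝ}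
    (hM : IsUnit M.det) (hρ : ρ ≠ 0) (u v : HorIdx n → ℝ) :
    innerA (weakCanonical M ρ) (ofHor u) (ofHor v) = M⁻¹.mulVec u ⬝ᵥ M⁻¹.mulVec v := by
  rw [innerA, weakCanonical_inv hM hρ, ofHor, ofHor, weakCanonical_mulVec, weakCanonical_mulVec,
    sumElim_dotProduct_sumElim]
  simp

/-- `diag(M, ρ)` is a weak canonical form of the invertible matrix `A`, where the inner
automorphism is conjugation by an element over `q`. -/
structure IsWeakForm (A : Matrix (HeisIdx n) (HeisIdx n) ℝ) (q : HorIdx n → ℝ)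
    (M : Matrix (HorIdx n) (HorIdx n) ℝ) (ρ : ℝ) : Prop where
  isUnit_det : IsUnit M.det
  ne_zero : ρ ≠ 0
  abs_det : |A.det| = |M.det| * |ρ|
  metric_eq : ∀ x u v : Heis n, metric A x u v = M⁻¹.mulVec (hor u) ⬝ᵥ M⁻¹.mulVec (hor v) +
    (ρ⁻¹) ^ 2 * (u (Sum.inr ()) + symp (q - (1 / 2 : ℝ) • hor x) (hor u)) *
      (v (Sum.inr ()) + symp (q - (1 / 2 : ℝ) • hor x) (hor v))

theorem isWeakForm {A R : Matrix (HeisIdx n) (HeisIdx n) ℝ} {g : Heis n}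
    {M : Matrix (HorIdx n) (HorIdx n) ℝ} {ρ : ℝ} (hA : IsUnit A.det)
    (hR : R ∈ Matrix.orthogonalGroup (HeisIdx n) ℝ)
    (h : innMatrix g * A * R = weakCanonical M ρ) : IsWeakForm A (hor g) M ρ := by
  rw [innMatrix_eq] at h
  have hRR : R * R.transpose = 1 := (Matrix.mem_orthogonalGroup_iff _ _).1 hR
  have hRR' : R.transpose * R = 1 := (Matrix.mem_orthogonalGroup_iff' _ _).1 hR
  have hdR := Matrix.abs_det_of_mem_orthogonalGroup hR
  have hdet : |A.det| = |M.det| * |ρ| := by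
    rw [← abs_mul, ← det_weakCanonical, ← h, Matrix.det_mul, Matrix.det_mul, det_shear, one_mul,
      abs_mul, hdR, mul_one]
  have hpos : 0 < |M.det| * |ρ| := hdet ▸ abs_pos.2 hA.ne_zero
  have hM : IsUnit M.det := isUnit_iff_ne_zero.2 fun h0 => by simp [h0] at hpos
  have hρ : ρ ≠ 0 := fun h0 => by simp [h0] at hpos
  have hinv : A⁻¹ = R * weakCanonical M⁻¹ ρ⁻¹ * shear (hor g) := by
    refine Matrix.inv_eq_left_inv ?_
    have h1 : shear (hor g) * A = weakCanonical M ρ * R.transpose := by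
      rw [← h, Matrix.mul_assoc, hRR, Matrix.mul_one]
    rw [Matrix.mul_assoc, h1, ← weakCanonical_inv hM hρ, Matrix.mul_assoc, ← Matrix.mul_assoc _⁻¹,
      Matrix.nonsing_inv_mul, Matrix.one_mul, hRR]
    rw [det_weakCanonical]
    exact hM.mul (isUnit_iff_ne_zero.2 hρ)
  refine ⟨hM, hρ, hdet, fun x u v => ?_⟩
  have hRd (a b : HeisIdx n → ℝ) : R.mulVec a ⬝ᵥ R.mulVec b = a ⬝ᵥ b := by
    rw [Matrix.dotProduct_mulVec, ← Matrix.mulVec_transpose, Matrix.mulVec_mulVec, hRR',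
      Matrix.one_mulVec]
  rw [metric_eq, hinv, Matrix.mul_assoc, shear_mul_shear,
    show hor g + -(1 / 2 : ℝ) • hor x = hor g - (1 / 2 : ℝ) • hor x by
      rw [neg_smul, sub_eq_add_neg]]
  set a := hor g - (1 / 2 : ℝ) • hor x
  rw [← Matrix.mulVec_mulVec (coord u), ← Matrix.mulVec_mulVec (coord v),
    ← Matrix.mulVec_mulVec, ← Matrix.mulVec_mulVec, hRd, coord_eq, coord_eq, shear_mulVec, shear_mulVec, weakCanonical_mulVec,
    weakCanonical_mulVec, sumElim_dotProduct_sumElim]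
  simp only [dotProduct, Finset.univ_unique, Finset.sum_singleton]
  ring

end Heis

/-! ### The Ricci tensor of a metric `H + c θ ⊗ θ` with `θ` affine -/

section Ricci

variable {ι : Type*} [Fintype ι] [DecidableEq ι]

theorem pderiv_add {f g : (ι → ℝ) → ℝ} (hf : Differentiable ℝ f) (hg : Differentiable ℝ g)
    (i : ι) (x : ι → ℝ) : pderiv i (fun y => f y + g y) x = pderiv i f x + pderiv i g x := by
  simp [pderiv, fderiv_fun_add (hf x) (hg x)]

theorem pderiv_mul {f g : (ι → ℝ) → ℝ} (hf : Differentiable ℝ f) (hg : Differentiable ℝ g)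
    (i : ι) (x : ι → ℝ) :
    pderiv i (fun y => f y * g y) x = f x * pderiv i g x + g x * pderiv i f x := by
  simp [pderiv, fderiv_fun_mul (hf x) (hg x)]

theorem pderiv_const (t : ℝ) (i : ι) (x : ι → ℝ) : pderiv i (fun _ => t) x = 0 := by
  simp [pderiv]

theorem pderiv_const_mul {f : (ι → ℝ) → ℝ} (hf : Differentiable ℝ f) (t : ℝ)
    (i : ι) (x : ι → ℝ) : pderiv i (fun y => t * f y) x = t * pderiv i f x := by
  rw [pderiv_mul (differentiable_const t) hf, pderiv_const]; ring

theorem pderiv_sum {κ : Type*} [Fintype κ] {f : κ → (ι → ℝ) → ℝ}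
    (hf : ∀ k, Differentiable ℝ (f k)) (i : ι) (x : ι → ℝ) :
    pderiv i (fun y => ∑ k, f k y) x = ∑ k, pderiv i (f k) x := by
  simp [pderiv, fderiv_fun_sum fun k _ => hf k x]

theorem pderiv_apply (i a : ι) (x : ι → ℝ) :
    pderiv i (fun y => y a) x = if a = i then 1 else 0 := by
  have : HasFDerivAt (fun y : ι → ℝ => y a) (ContinuousLinearMap.proj (R := ℝ) a) x :=
    (ContinuousLinearMap.proj (R := ℝ) (φ := fun _ : ι => ℝ) a).hasFDerivAt
  rw [pderiv, this.fderiv]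
  simp [Pi.single_apply]

/-- The affine family of linear forms `θ_x = dz + S(q - x / 2, ·)`. -/
def contactForm (S : Matrix ι ι ℝ) (z : ι) (q x : ι → ℝ) (i : ι) : ℝ :=
  (if i = z then 1 else 0) + ∑ a, (q a - 1 / 2 * x a) * S a i

variable {H N S : Matrix ι ι ℝ} {z : ι} {c : ℝ} {q : ι → ℝ}

theorem differentiable_contactForm (i : ι) :
    Differentiable ℝ fun x => contactForm S z q x i := by
  unfold contactForm
  fun_prop

theorem pderiv_contactForm (a i : ι) (x : ι → ℝ) :
    pderiv a (fun y => contactForm S z q y i) x = -(1 / 2) * S a i := by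
  unfold contactForm
  rw [pderiv_add (by fun_prop) (by fun_prop), pderiv_const, pderiv_sum (fun k => by fun_prop)]
  have h (b : ι) : (fun y : ι → ℝ => (q b - 1 / 2 * y b) * S b i) =
      fun y => q b * S b i + (-(1 / 2) * S b i) * y b := by
    funext y; ring
  simp only [h]
  have h2 (b : ι) : pderiv a (fun y : ι → ℝ => q b * S b i + (-(1 / 2) * S b i) * y b) x =
      if b = a then -(1 / 2) * S b i else 0 := by
    rw [pderiv_add (by fun_prop) (by fun_prop), pderiv_const, pderiv_const_mul (by fun_prop),
      pderiv_apply]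
    simp
  simp only [h2]
  simp

theorem contactForm_self (hSz : ∀ a, S a z = 0) (x : ι → ℝ) : contactForm S z q x z = 1 := by
  simp [contactForm, hSz]

/-- The components `τ_i^k` of the `g`-gradients of the forms `S(e_i, ·)`, for
`g = H + c θ ⊗ θ` and `N` the partial inverse of `H`. -/
def contactGrad (N S : Matrix ι ι ℝ) (z : ι) (q x : ι → ℝ) (i k : ι) : ℝ :=
  (S * N) i k + (if k = z then -1 else 0) * ∑ m, (S * N) i m * contactForm S z q x m

theorem differentiable_contactGrad (i k : ι) :
    Differentiable ℝ fun x => contactGrad N S z q x i k := by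
  have := fun i => differentiable_contactForm (S := S) (z := z) (q := q) i
  unfold contactGrad
  fun_prop

theorem pderiv_contactGrad (a i k : ι) (x : ι → ℝ) :
    pderiv a (fun y => contactGrad N S z q y i k) x =
      (if k = z then 1 / 2 else 0) * ∑ m, (S * N) i m * S a m := by
  have h := fun i => differentiable_contactForm (S := S) (z := z) (q := q) i
  unfold contactGrad
  rw [pderiv_add (by fun_prop) (by fun_prop), pderiv_const, pderiv_const_mul (by fun_prop),
    pderiv_sum (fun k => by fun_prop)]
  simp only [pderiv_const_mul (h _), pderiv_contactForm, zero_add, Finset.mul_sum]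
  refine Finset.sum_congr rfl fun m _ => ?_
  split_ifs <;> ring

theorem sum_contactForm_mul_contactGrad (hSz : ∀ a, S a z = 0) (x : ι → ℝ) (i : ι) :
    ∑ k, contactForm S z q x k * contactGrad N S z q x i k = 0 := by
  simp only [contactGrad, mul_add, Finset.sum_add_distrib]
  simp only [ite_mul, neg_mul, one_mul, zero_mul, mul_ite, mul_zero, Finset.sum_ite_eq',
    Finset.mem_univ, if_true, contactForm_self hSz]
  simp only [mul_comm]
  ring

/-- The inverse metric applied to the form `S(e_i, ·)`. -/
theorem inv_mulVec_row (g : Matrix ι ι ℝ) (x : ι → ℝ) (hdet : IsUnit g.det)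
    (hg : ∀ i j, g i j = H i j + c * contactForm S z q x i * contactForm S z q x j)
    (hHz : ∀ i, H i z = 0) (hSz : ∀ a, S a z = 0) (hN : N.transpose = N)
    (hHN : ∀ i j, (H * N) i j = (1 : Matrix ι ι ℝ) i j - if i = z then if j = z then 1 else 0 else 0)
    (i k : ι) : ∑ l, g⁻¹ k l * S i l = contactGrad N S z q x i k := by
  have h : g.mulVec (contactGrad N S z q x i) = S i := by
    ext j
    have h1 : ∑ k, H j k * contactGrad N S z q x i k = S i j := by
      have h2 : ∀ k, H j k * contactGrad N S z q x i k = H j k * (S * N) i k := by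
        intro k
        rw [contactGrad]
        by_cases hk : k = z
        · simp [hk, hHz]
        · simp [hk]
      simp only [h2]
      have h3 : ∑ k, H j k * (S * N) i k = (H * (S * N).transpose) j i := rfl
      rw [h3, Matrix.transpose_mul, hN, ← Matrix.mul_assoc, Matrix.mul_apply]
      simp only [hHN, sub_mul, Finset.sum_sub_distrib, Matrix.transpose_apply]
      rw [← Finset.sum_congr rfl fun l _ => congrArg _ (Matrix.transpose_apply S l i),
        ← Matrix.mul_apply, Matrix.one_mul]
      by_cases hj : j = z <;> simp [hj, hSz]
    have h4 := sum_contactForm_mul_contactGrad (N := N) (q := q) hSz x i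
    simp only [Matrix.mulVec, dotProduct, hg, add_mul, Finset.sum_add_distrib, h1, mul_assoc]
    rw [← Finset.mul_sum, ← Finset.mul_sum, h4]
    simp
  have h2 := congrArg (g⁻¹.mulVec) h
  rw [Matrix.mulVec_mulVec, Matrix.nonsing_inv_mul _ hdet, Matrix.one_mulVec] at h2
  exact (congrFun h2 k).symm

variable {g : (ι → ℝ) → Matrix ι ι ℝ}

theorem christoffel_contact (hdet : ∀ x, IsUnit (g x).det)
    (hg : ∀ x i j, g x i j = H i j + c * contactForm S z q x i * contactForm S z q x j)
    (hHz : ∀ i, H i z = 0) (hS : ∀ a b, S a b = -S b a) (hSz : ∀ a, S a z = 0)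
    (hN : N.transpose = N)
    (hHN : ∀ i j, (H * N) i j = (1 : Matrix ι ι ℝ) i j - if i = z then if j = z then 1 else 0 else 0)
    (k i j : ι) : christoffel g k i j = fun x =>
      -(c / 2) * (contactForm S z q x j * contactGrad N S z q x i k +
        contactForm S z q x i * contactGrad N S z q x j k) := by
  have h := fun i => differentiable_contactForm (S := S) (z := z) (q := q) i
  have hd (a i j : ι) (x : ι → ℝ) : pderiv a (fun y => g y i j) x =
      -(c / 2) * (contactForm S z q x i * S a j + contactForm S z q x j * S a i) := by
    simp only [hg, mul_assoc]
    rw [pderiv_add (by fun_prop) (by fun_prop), pderiv_const, pderiv_const_mul (by fun_prop),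
      pderiv_mul (h i) (h j), pderiv_contactForm, pderiv_contactForm]
    ring
  funext x
  rw [← inv_mulVec_row (g x) x (hdet x) (hg x) hHz hSz hN hHN i k,
    ← inv_mulVec_row (g x) x (hdet x) (hg x) hHz hSz hN hHN j k, christoffel]
  simp only [hd, Finset.mul_sum, ← Finset.sum_add_distrib]
  refine Finset.sum_congr rfl fun l _ => ?_
  rw [hS j i, hS l i, hS l j]
  ring

/-- The horizontal Ricci curvature of `H + c θ ⊗ θ` at a point where `θ = dz`. -/
theorem ricci_contact (hdet : ∀ x, IsUnit (g x).det)
    (hg : ∀ x i j, g x i j = H i j + c * contactForm S z q x i * contactForm S z q x j)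
    (hHz : ∀ i, H i z = 0) (hS : ∀ a b, S a b = -S b a) (hSz : ∀ a, S a z = 0)
    (hN : N.transpose = N) (hNz : ∀ a, N a z = 0)
    (hHN : ∀ i j, (H * N) i j = (1 : Matrix ι ι ℝ) i j - if i = z then if j = z then 1 else 0 else 0)
    {x : ι → ℝ} (hx : ∀ i, contactForm S z q x i = if i = z then 1 else 0)
    {u : ι → ℝ} (hu : u z = 0) :
    ricci g x u u = -(c / 2) * (u ⬝ᵥ (S * N * S.transpose).mulVec u) := by
  have hF := fun i => differentiable_contactForm (S := S) (z := z) (q := q) i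
  have hG := fun i k => differentiable_contactGrad (N := N) (S := S) (z := z) (q := q) i k
  have hTz (i : ι) : (S * N) i z = 0 := by simp [Matrix.mul_apply, hNz]
  have hgrad (i k : ι) : contactGrad N S z q x i k = (S * N) i k := by
    simp [contactGrad, hx, hTz]
  have hΓ := christoffel_contact hdet hg hHz hS hSz hN hHN
  have hΓx (k i j : ι) : christoffel g k i j x =
      -(c / 2) * ((if j = z then 1 else 0) * (S * N) i k +
        (if i = z then 1 else 0) * (S * N) j k) := by
    rw [hΓ]; simp only [hx, hgrad]
  have hdΓ (a k i j : ι) : pderiv a (christoffel g k i j) x =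
      (c / 4) * (S a j * (S * N) i k + S a i * (S * N) j k
        - (if k = z then if j = z then 1 else 0 else 0) * ∑ m, (S * N) i m * S a m
        - (if k = z then if i = z then 1 else 0 else 0) * ∑ m, (S * N) j m * S a m) := by
    rw [hΓ, pderiv_const_mul (by fun_prop), pderiv_add (by fun_prop) (by fun_prop),
      pderiv_mul (hF j) (hG i k), pderiv_mul (hF i) (hG j k), pderiv_contactForm,
      pderiv_contactForm, pderiv_contactGrad, pderiv_contactGrad, hgrad, hgrad, hx, hx]
    split_ifs <;> ring
  have htr : ∑ i, (S * N) i i = 0 := by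
    have h1 : (S * N).trace = -(S * N).trace := by
      conv_lhs => rw [← Matrix.trace_transpose, Matrix.transpose_mul, hN,
        show S.transpose = -S by ext i j; simp [hS j i], Matrix.mul_neg, Matrix.trace_neg,
        Matrix.trace_mul_comm]
    have : (S * N).trace = 0 := by linarith
    exact this
  have hric (j k : ι) (hj : j ≠ z) (hk : k ≠ z) :
      ricciCoord g j k x = -(c / 2) * (S * N * S.transpose) j k := by
    have e1 : ∑ m, (S * N) j m * S k m = (S * N * S.transpose) j k := by
      simp [Matrix.mul_apply]
    have e2 : ∑ m, (S * N) k m * S j m = (S * N * S.transpose) j k := by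
      have : (S * N * S.transpose).transpose = S * N * S.transpose := by
        rw [Matrix.transpose_mul, Matrix.transpose_mul, Matrix.transpose_transpose, hN,
          Matrix.mul_assoc]
      conv_rhs => rw [← this, Matrix.transpose_apply]
      simp [Matrix.mul_apply]
    have e3 (i l : ι) : christoffel g i j l x * christoffel g l i k x = 0 := by
      rw [hΓx, hΓx]
      by_cases hi : i = z
      · subst hi; simp [hTz, hj, hk]
      · simp [hi, hk]
    have e4 (i l : ι) : christoffel g i i l x * christoffel g l j k x = 0 := by
      rw [hΓx l j k]; simp [hj, hk]
    simp only [ricciCoord, e3, e4, sub_zero, Finset.sum_const_zero, add_zero, hdΓ, hj, hk,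
      Finset.sum_sub_distrib, ← Finset.mul_sum, Finset.sum_add_distrib, htr, e2,
      if_false, ite_self, zero_mul, sub_zero, mul_zero]
    have e5 : ∑ i, S i k * (S * N) j i = -(S * N * S.transpose) j k := by
      rw [← e1, ← Finset.sum_neg_distrib]
      exact Finset.sum_congr rfl fun i _ => by rw [hS i k]; ring
    have e6 : ∑ i, S i j * (S * N) k i = -(S * N * S.transpose) j k := by
      rw [← e2, ← Finset.sum_neg_distrib]
      exact Finset.sum_congr rfl fun i _ => by rw [hS i j]; ring
    have e7 : ∑ i, S j i * (S * N) k i = (S * N * S.transpose) j k := by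
      rw [← e2]
      exact Finset.sum_congr rfl fun i _ => by ring
    have e8 : ∑ i, (if i = z then if i = z then (1 : ℝ) else 0 else 0) *
        (S * N * S.transpose) j k = (S * N * S.transpose) j k := by
      simp
    rw [e5, e6, e7, e8]
    ring
  rw [ricci, dotProduct, Finset.mul_sum]
  refine Finset.sum_congr rfl fun j _ => ?_
  rw [Matrix.mulVec, dotProduct, Finset.mul_sum, Finset.mul_sum]
  refine Finset.sum_congr rfl fun k _ => ?_
  by_cases hj : j = z
  · simp [hj, hu]
  by_cases hk : k = z
  · simp [hk, hu]
  rw [hric j k hj hk]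
  ring

end Ricci

/-! ### The spectrum of a skew-symmetric matrix -/

theorem Multiset.exists_eq_add_neg {n : ℕ} {L : Multiset ℝ} (hneg : L.map (fun x => -x) = L)
    (h0 : (0 : ℝ) ∉ L) (hcard : L.card = n + n) :
    ∃ d : Fin n → ℝ, (∀ k, 0 < d k) ∧ Monotone d ∧
      L = Finset.univ.val.map d + Finset.univ.val.map (fun k => -d k) := by
  set p := L.filter (fun x => 0 < x) with hp
  have h1 : L.filter (fun x => ¬ 0 < x) = p.map (fun x => -x) := by
    conv_lhs => rw [← hneg]
    rw [Multiset.filter_map, hp]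
    congr 1
    refine Multiset.filter_congr fun x hx => ?_
    have : x ≠ 0 := fun h => h0 (h ▸ hx)
    simp only [Function.comp_apply, not_lt]
    exact ⟨fun h => lt_of_le_of_ne (by linarith) this.symm, fun h => by linarith⟩
  have h2 : p + p.map (fun x => -x) = L := by rw [← h1, hp, Multiset.filter_add_not]
  have hpc : (p.sort (· ≤ ·)).length = n := by
    have := congrArg Multiset.card h2
    rw [Multiset.card_add, Multiset.card_map, hcard] at this
    rw [Multiset.length_sort]; omega
  have hd : Finset.univ.val.map (fun k : Fin n => (p.sort (· ≤ ·)).get (k.cast hpc.symm)) = p := by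
    rw [Fin.univ_val_map]
    conv_rhs => rw [← Multiset.sort_eq p (· ≤ ·)]
    congr 1
    refine List.ext_get (by simp [hpc]) fun i hi hi' => by simp
  refine ⟨fun k => (p.sort (· ≤ ·)).get (k.cast hpc.symm), fun k => ?_, fun i j hij => ?_, ?_⟩
  · have := List.get_mem (p.sort (· ≤ ·)) (k.cast hpc.symm)
    exact (Multiset.mem_filter.1 ((Multiset.mem_sort _).1 this)).2
  · exact (Multiset.pairwise_sort p (· ≤ ·)).sortedLE.monotone_get hij
  · conv_lhs => rw [← h2, ← hd, Multiset.map_map]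
    rfl

open Polynomial in
theorem Matrix.charpoly_of_skew {n : ℕ} {S : Matrix (Fin n ⊕ Fin n) (Fin n ⊕ Fin n) ℝ}
    (hS : S.transpose = -S) (hdet : S.det ≠ 0) :
    ∃ d : Fin n → ℝ, (∀ k, 0 < d k) ∧ Monotone d ∧ S.charpoly.map (algebraMap ℝ ℂ) =
      ∏ k, ((X - C (Complex.I * (d k : ℂ))) * (X + C (Complex.I * (d k : ℂ)))) := by
  set T : Matrix (Fin n ⊕ Fin n) (Fin n ⊕ Fin n) ℂ := S.map (algebraMap ℝ ℂ) with hT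
  have hTt : T.transpose = -T := by
    rw [hT, ← Matrix.transpose_map, hS]; ext i j; simp
  have hTh : T.conjTranspose = -T := by
    rw [← hTt]; ext i j; simp [hT, Matrix.conjTranspose_apply]
  have hM : (Complex.I • T).IsHermitian := by
    rw [Matrix.IsHermitian, Matrix.conjTranspose_smul, hTh]; simp
  set l := hM.eigenvalues
  set P : ℝ[X] := ∏ i, (X - C (l i)) with hP
  have hPM : P.map (algebraMap ℝ ℂ) = (Complex.I • T).charpoly := by
    rw [hM.charpoly_eq, hP, Polynomial.map_prod]
    simp
    rfl
  have heven : P.comp (-X) = P := by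
    refine Polynomial.map_injective _ (algebraMap ℝ ℂ).injective ?_
    rw [Polynomial.map_comp, hPM]
    refine Polynomial.funext fun x => ?_
    rw [eval_comp]
    conv_rhs => rw [← Matrix.charpoly_transpose]
    rw [Matrix.eval_charpoly, Matrix.eval_charpoly, Matrix.transpose_smul, hTt]
    have : Matrix.scalar (Fin n ⊕ Fin n) (eval x (Polynomial.map (algebraMap ℝ ℂ) (-X))) -
        Complex.I • T = -(Matrix.scalar (Fin n ⊕ Fin n) x - Complex.I • -T) := by
      simp [← Matrix.smul_one_eq_diagonal, sub_eq_add_neg, add_comm]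
    rw [this, Matrix.det_neg]
    simp
  have hroots : P.roots = Finset.univ.val.map l := by
    have : P = (Multiset.map (fun a => X - C a) (Finset.univ.val.map l)).prod := by
      rw [hP, Multiset.map_map]; rfl
    rw [this, Polynomial.roots_multiset_prod_X_sub_C]
  obtain ⟨d, hd0, hdm, hd⟩ := Multiset.exists_eq_add_neg (n := n) (L := Finset.univ.val.map l)
    (by rw [← hroots, ← Polynomial.roots_comp_neg_X, heven])
    (by
      intro h
      obtain ⟨i, -, hi⟩ := Multiset.mem_map.1 h
      have h1 : (Complex.I • T).det = 0 := by
        rw [hM.det_eq_prod_eigenvalues]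
        exact Finset.prod_eq_zero (Finset.mem_univ i) (by simpa [l] using hi)
      rw [Matrix.det_smul, hT, ← RingHom.mapMatrix_apply, ← RingHom.map_det] at h1
      simp [hdet] at h1)
    (by simp)
  refine ⟨d, hd0, hdm, Polynomial.funext fun x => ?_⟩
  have hPd : P = ∏ k, ((X - C (d k)) * (X + C (d k))) := by
    have : P = (Multiset.map (fun a => X - C a) (Finset.univ.val.map l)).prod := by
      rw [hP, Multiset.map_map]; rfl
    rw [this, hd, Multiset.map_add, Multiset.prod_add, Multiset.map_map, Multiset.map_map,
      Finset.prod_mul_distrib]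
    simp [Finset.prod]
  have h1 : (S.charpoly.map (algebraMap ℝ ℂ)).eval x =
      (-1) ^ n * ((Complex.I • T).charpoly).eval (Complex.I * x) := by
    rw [← Matrix.charpoly_map, Matrix.eval_charpoly, Matrix.eval_charpoly]
    have : Matrix.scalar (Fin n ⊕ Fin n) (Complex.I * x) - Complex.I • T =
        Complex.I • (Matrix.scalar (Fin n ⊕ Fin n) x - T) := by
      simp [← Matrix.smul_one_eq_diagonal, smul_sub, mul_smul]
    rw [this, Matrix.det_smul, Fintype.card_sum, Fintype.card_fin, ← mul_assoc,
      ← two_mul, pow_mul, Complex.I_sq, ← mul_pow]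
    simp
    rfl
  rw [h1, ← hPM, hPd, Polynomial.map_prod, Polynomial.eval_prod, Polynomial.eval_prod,
    show (-1 : ℂ) ^ n = ∏ _k : Fin n, (-1 : ℂ) by simp, ← Finset.prod_mul_distrib]
  refine Finset.prod_congr rfl fun k _ => ?_
  simp
  linear_combination (x ^ 2 - (d k : ℂ) ^ 2) * (-Complex.I_sq)

open Polynomial in
theorem Matrix.det_eq_sq_of_charpoly {n : ℕ} {S : Matrix (Fin n ⊕ Fin n) (Fin n ⊕ Fin n) ℝ}
    {d : Fin n → ℝ} (h : S.charpoly.map (algebraMap ℝ ℂ) =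
      ∏ k, ((X - C (Complex.I * (d k : ℂ))) * (X + C (Complex.I * (d k : ℂ))))) :
    S.det = (∏ k, d k) ^ 2 := by
  have h1 := congrArg (eval 0) h
  rw [← Matrix.charpoly_map, Matrix.eval_charpoly, Polynomial.eval_prod] at h1
  simp only [map_zero, zero_sub, Matrix.det_neg, eval_mul, eval_sub, eval_add, eval_X,
    eval_C, zero_add, Fintype.card_sum, Fintype.card_fin] at h1
  rw [← RingHom.mapMatrix_apply, ← RingHom.map_det, Even.neg_one_pow ⟨n, rfl⟩, one_mul] at h1
  rw [← Finset.prod_pow]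
  have h2 : (S.det : ℂ) = ((∏ k, d k ^ 2 : ℝ) : ℂ) := by
    rw [show (S.det : ℂ) = algebraMap ℝ ℂ S.det from rfl, h1]
    push_cast
    refine Finset.prod_congr rfl fun k _ => ?_
    linear_combination -(d k : ℂ) ^ 2 * Complex.I_sq
  exact_mod_cast h2

open Polynomial in
/-- A bound for the quadratic form `|S w|²` bounds the eigenvalues of a real matrix `S`. -/
theorem Matrix.sq_le_of_charpoly {n : ℕ} {S : Matrix (Fin n ⊕ Fin n) (Fin n ⊕ Fin n) ℝ}
    {d : Fin n → ℝ} (h : S.charpoly.map (algebraMap ℝ ℂ) =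
      ∏ k, ((X - C (Complex.I * (d k : ℂ))) * (X + C (Complex.I * (d k : ℂ)))))
    {b : ℝ} (hb : ∀ w, S.mulVec w ⬝ᵥ S.mulVec w ≤ b * (w ⬝ᵥ w)) (k : Fin n) : d k ^ 2 ≤ b := by
  have h1 := congrArg (eval (Complex.I * (d k : ℂ))) h
  rw [← Matrix.charpoly_map, Matrix.eval_charpoly, Polynomial.eval_prod,
    Finset.prod_eq_zero (Finset.mem_univ k) (by simp)] at h1
  obtain ⟨v, hv0, hv⟩ := Matrix.exists_mulVec_eq_zero_iff.2 h1
  rw [Matrix.sub_mulVec, sub_eq_zero, Matrix.scalar_apply, ← Matrix.smul_one_eq_diagonal,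
    Matrix.smul_mulVec, Matrix.one_mulVec] at hv
  have hre : S.mulVec (fun i => (v i).re) = -d k • fun i => (v i).im := by
    ext i
    have := congrArg Complex.re (congrFun hv i)
    simp only [Pi.smul_apply, smul_eq_mul] at this ⊢
    rw [Complex.mul_re, Complex.mul_re] at this
    simp [Matrix.mulVec, dotProduct] at this ⊢
    linarith
  have him : S.mulVec (fun i => (v i).im) = d k • fun i => (v i).re := by
    ext i
    have := congrArg Complex.im (congrFun hv i)
    simp only [Pi.smul_apply, smul_eq_mul] at this ⊢
    rw [Complex.mul_im, Complex.mul_im] at this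
    simp [Matrix.mulVec, dotProduct] at this ⊢
    linarith
  have b1 := hb (fun i => (v i).re)
  have b2 := hb (fun i => (v i).im)
  rw [hre] at b1
  rw [him] at b2
  simp only [smul_dotProduct, dotProduct_smul, smul_eq_mul] at b1 b2
  set x := (fun i => (v i).re) ⬝ᵥ fun i => (v i).re
  set y := (fun i => (v i).im) ⬝ᵥ fun i => (v i).im
  have hx : 0 ≤ x := Finset.sum_nonneg fun i _ => mul_self_nonneg _
  have hy : 0 ≤ y := Finset.sum_nonneg fun i _ => mul_self_nonneg _
  have hpos : 0 < x + y := by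
    refine lt_of_le_of_ne (add_nonneg hx hy) fun h0 => hv0 ?_
    have hx0 : x = 0 := by linarith
    have hy0 : y = 0 := by linarith
    have e1 := dotProduct_self_eq_zero.1 hx0
    have e2 := dotProduct_self_eq_zero.1 hy0
    ext i
    exact Complex.ext (congrFun e1 i) (congrFun e2 i)
  have : d k ^ 2 * (x + y) ≤ b * (x + y) := by nlinarith
  exact le_of_mul_le_mul_right this hpos

namespace Heis

variable {n : ℕ}

/-- The matrix of `j` for `diag(M, ρ)` in the orthonormal frame given by `M`. -/
def jMatrix (M : Matrix (HorIdx n) (HorIdx n) ℝ) : Matrix (HorIdx n) (HorIdx n) ℝ :=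
  M.transpose * (sympMatrix n).transpose * M

theorem jMatrix_transpose (M : Matrix (HorIdx n) (HorIdx n) ℝ) :
    (jMatrix M).transpose = -jMatrix M := by
  simp [jMatrix, Matrix.transpose_mul, sympMatrix_transpose, Matrix.mul_assoc]

theorem det_sympMatrix_sq : (sympMatrix n).det * (sympMatrix n).det = 1 := by
  have := congrArg Matrix.det (sympMatrix_mul_transpose (n := n))
  rwa [Matrix.det_mul, Matrix.det_transpose, Matrix.det_one] at this

theorem abs_det_jMatrix (M : Matrix (HorIdx n) (HorIdx n) ℝ) :
    |(jMatrix M).det| = |M.det| ^ 2 := by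
  have h : |(sympMatrix n).det| = 1 :=
    (abs_eq (by norm_num)).2 (mul_self_eq_one_iff.1 det_sympMatrix_sq)
  rw [jMatrix, Matrix.det_mul, Matrix.det_mul, Matrix.det_transpose, Matrix.det_transpose,
    abs_mul, abs_mul, h]
  ring

theorem isJOperator_weakCanonical {M : Matrix (HorIdx n) (HorIdx n) ℝ} {ρ : ℝ}
    (hM : IsUnit M.det) (hρ : ρ ≠ 0) : IsJOperator (weakCanonical M ρ)
      (Matrix.toLin' (M * (M.transpose * (sympMatrix n).transpose))) := by
  intro U V
  rw [innerA_weakCanonical_ofHor hM hρ, Matrix.toLin'_apply, Matrix.mulVec_mulVec,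
    ← Matrix.mul_assoc, Matrix.nonsing_inv_mul _ hM, Matrix.one_mul, symp_eq,
    Matrix.dotProduct_mulVec, ← Matrix.mulVec_transpose, Matrix.mulVec_mulVec,
    ← Matrix.mul_assoc, ← Matrix.transpose_mul, Matrix.mul_nonsing_inv _ hM,
    Matrix.transpose_one, Matrix.one_mul, Matrix.mulVec_transpose, ← Matrix.dotProduct_mulVec]

open Polynomial in
theorem exists_isJSpectrum {M : Matrix (HorIdx n) (HorIdx n) ℝ} {ρ : ℝ}
    (hM : IsUnit M.det) (hρ : ρ ≠ 0) : ∃ d, IsJSpectrum (weakCanonical M ρ) d ∧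
      ∏ k, d k = |M.det| ∧
      ∀ b : ℝ, (∀ w, (jMatrix M).mulVec w ⬝ᵥ (jMatrix M).mulVec w ≤ b * (w ⬝ᵥ w)) →
        ∀ k, d k ^ 2 ≤ b := by
  have hpos : 0 < |M.det| := abs_pos.2 hM.ne_zero
  have hdet : (jMatrix M).det ≠ 0 := by
    rw [← abs_pos, abs_det_jMatrix]; positivity
  obtain ⟨d, hd0, hdm, hd⟩ := Matrix.charpoly_of_skew (jMatrix_transpose M) hdet
  refine ⟨d, ⟨hd0, hdm, _, isJOperator_weakCanonical hM hρ, ?_⟩, ?_, fun b hb =>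
    Matrix.sq_le_of_charpoly hd hb⟩
  · rw [Matrix.charpoly_toLin', Matrix.charpoly_mul_comm, ← hd, jMatrix]
  · have h1 := Matrix.det_eq_sq_of_charpoly hd
    have h2 := abs_det_jMatrix M
    rw [h1, abs_of_nonneg (sq_nonneg _)] at h2
    have h3 : 0 ≤ ∏ k, d k := Finset.prod_nonneg fun k _ => (hd0 k).le
    exact (pow_left_inj₀ h3 hpos.le two_ne_zero).1 h2

variable {A : Matrix (HeisIdx n) (HeisIdx n) ℝ} {M : Matrix (HorIdx n) (HorIdx n) ℝ} {ρ : ℝ}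
  {q : HorIdx n → ℝ}

theorem hor_basisVec_inl (b : HorIdx n) :
    hor (basisVec (Sum.inl b) : Heis n) = Pi.single b 1 := by
  ext a
  refine (Pi.single_apply (Sum.inl b : HeisIdx n) (1 : ℝ) _).trans ?_
  simp [Pi.single_apply]

theorem hor_basisVec_inr (c : Unit) : hor (basisVec (Sum.inr c) : Heis n) = 0 := by
  ext a
  refine (Pi.single_apply (Sum.inr c : HeisIdx n) (1 : ℝ) (Sum.inl a)).trans ?_
  simp

theorem contactForm_eq (q : HorIdx n → ℝ) (x : Heis n) (i : HeisIdx n) :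
    contactForm (Matrix.fromBlocks (sympMatrix n) 0 0 0) (Sum.inr ()) (Sum.elim q fun _ => 0)
      (coord x) i = (basisVec i : Heis n) (Sum.inr ()) +
        symp (q - (1 / 2 : ℝ) • hor x) (hor (basisVec i)) := by
  rw [contactForm, show (basisVec i : Heis n) (Sum.inr ()) = if i = Sum.inr () then 1 else 0 from
    (Pi.single_apply i (1 : ℝ) _).trans (by simp only [eq_comm])]
  congr 1
  rw [Fintype.sum_sum_type]
  rcases i with b | c
  · rw [hor_basisVec_inl, symp_eq]
    simp [dotProduct, coord_inl]
  · rw [hor_basisVec_inr, symp_eq]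
    simp

theorem IsWeakForm.metricMatrix_apply (hW : IsWeakForm A q M ρ) (x : Heis n) (i j : HeisIdx n) :
    metricMatrix A x i j =
      Matrix.fromBlocks ((M⁻¹).transpose * M⁻¹) 0 0 0 i j + (ρ⁻¹) ^ 2 *
      contactForm (Matrix.fromBlocks (sympMatrix n) 0 0 0) (Sum.inr ()) (Sum.elim q fun _ => 0)
        (coord x) i *
      contactForm (Matrix.fromBlocks (sympMatrix n) 0 0 0) (Sum.inr ()) (Sum.elim q fun _ => 0)
        (coord x) j := by
  refine (hW.metric_eq x (basisVec i) (basisVec j)).trans ?_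
  rw [contactForm_eq, contactForm_eq]
  congr 1
  rcases i with i | i <;> rcases j with j | j <;> simp only [hor_basisVec_inl, hor_basisVec_inr] <;>
    simp [Matrix.mul_apply, dotProduct]

theorem IsWeakForm.jMatrix_le (hA : IsUnit A.det) (hW : IsWeakForm A q M ρ) {K : ℝ}
    (hK : RicciGe A K) (w : HorIdx n → ℝ) :
    (jMatrix M).mulVec w ⬝ᵥ (jMatrix M).mulVec w ≤ 2 * K * ρ ^ 2 * (w ⬝ᵥ w) := by
  set x : Heis n := ofHor ((2 : ℝ) • q)
  have hx : q - (1 / 2 : ℝ) • hor x = 0 := by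
    rw [show hor x = (2 : ℝ) • q from rfl, smul_smul]; norm_num
  set u : Heis n := ofHor (M.mulVec w)
  have hu : hor u = M.mulVec w := rfl
  have huz : u (Sum.inr ()) = 0 := rfl
  have hMM : M⁻¹ * M = 1 := Matrix.nonsing_inv_mul _ hW.isUnit_det
  have hMM' : M * M⁻¹ = 1 := Matrix.mul_nonsing_inv _ hW.isUnit_det
  have h1 : metric A x u u = w ⬝ᵥ w := by
    rw [hW.metric_eq, hx, hu, huz, Matrix.mulVec_mulVec, hMM, Matrix.one_mulVec]
    simp [symp_eq]
  have h2 : ricci (metricMatrix A) x u u = -((ρ⁻¹) ^ 2 / 2) *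
      ((jMatrix M).mulVec w ⬝ᵥ (jMatrix M).mulVec w) := by
    refine (ricci_contact (g := metricMatrix A)
      (H := Matrix.fromBlocks ((M⁻¹).transpose * M⁻¹) 0 0 0)
      (N := Matrix.fromBlocks (M * M.transpose) 0 0 0)
      (S := Matrix.fromBlocks (sympMatrix n) 0 0 0) (z := Sum.inr ()) (c := (ρ⁻¹) ^ 2)
      (q := Sum.elim q fun _ => 0) (fun y => ?_) hW.metricMatrix_apply ?_ ?_ ?_ ?_ ?_ ?_
      (fun i => ?_) huz).trans ?_
    · rw [isUnit_iff_ne_zero]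
      intro h
      have := sqrt_det_metricMatrix A y
      rw [h, Real.sqrt_zero, eq_comm, inv_eq_zero, abs_eq_zero] at this
      exact hA.ne_zero this
    · rintro (i | i) <;> rfl
    · have h := sympMatrix_transpose (n := n)
      rintro (i | i) (j | j) <;> simp
      exact congrFun (congrFun h j) i
    · rintro (i | i) <;> rfl
    · simp [Matrix.fromBlocks_transpose, Matrix.transpose_mul]
    · rintro (i | i) <;> rfl
    · intro i j
      have h : (M⁻¹).transpose * M⁻¹ * (M * M.transpose) = 1 := by
        rw [Matrix.mul_assoc, ← Matrix.mul_assoc M⁻¹, hMM, Matrix.one_mul,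
          ← Matrix.transpose_mul, hMM', Matrix.transpose_one]
      rw [Matrix.fromBlocks_multiply]
      simp only [h, Matrix.zero_mul, Matrix.mul_zero, add_zero]
      rcases i with i | i <;> rcases j with j | j <;> simp [Matrix.one_apply]
    · refine (contactForm_eq q x i).trans ?_
      rw [hx, symp_eq, zero_dotProduct, add_zero]
      exact (Pi.single_apply i (1 : ℝ) _).trans (by simp only [eq_comm])
    · congr 1
      rw [show (u : HeisIdx n → ℝ) = Sum.elim (M.mulVec w) fun _ => 0 from rfl,
        Matrix.fromBlocks_multiply, Matrix.fromBlocks_transpose, Matrix.fromBlocks_multiply,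
        Matrix.fromBlocks_mulVec, sumElim_dotProduct_sumElim]
      simp only [jMatrix, Matrix.mul_zero, Matrix.zero_mul, add_zero, Matrix.transpose_zero,
        Matrix.zero_mulVec, dotProduct_zero, Sum.elim_comp_inl]
      rw [← Matrix.mulVec_mulVec, ← Matrix.mul_assoc, Matrix.mul_assoc, ← Matrix.mulVec_mulVec,
        Matrix.dotProduct_mulVec, ← Matrix.mulVec_transpose, ← Matrix.mulVec_mulVec w,
        ← Matrix.mulVec_mulVec (M.mulVec w), ← Matrix.mulVec_mulVec _ M,
        Matrix.dotProduct_mulVec, ← Matrix.mulVec_transpose]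
  have h3 := hK x u
  rw [h1, h2] at h3
  have hρ := hW.ne_zero
  have h4 : (jMatrix M).mulVec w ⬝ᵥ (jMatrix M).mulVec w =
      2 * ρ ^ 2 * ((ρ⁻¹) ^ 2 / 2 * ((jMatrix M).mulVec w ⬝ᵥ (jMatrix M).mulVec w)) := by
    field_simp
  rw [h4]
  have : 0 < ρ ^ 2 := by positivity
  nlinarith


/-- The projection `P`, in the orthonormal frame of `𝔳₀` given by the matrix `M`. -/
def horCLM (M : Matrix (HorIdx n) (HorIdx n) ℝ) : Heis n →L[ℝ] EuclideanSpace ℝ (HorIdx n) :=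
  LinearMap.toContinuousLinearMap
    { toFun := fun x => WithLp.toLp 2 (M⁻¹.mulVec (hor x))
      map_add' := fun x y => by
        rw [show hor (x + y) = hor x + hor y from rfl, Matrix.mulVec_add]; rfl
      map_smul' := fun t x => by
        rw [show hor (t • x) = t • hor x from rfl, Matrix.mulVec_smul]; rfl }

theorem norm_horCLM (x : Heis n) :
    ‖horCLM M x‖ = Real.sqrt (M⁻¹.mulVec (hor x) ⬝ᵥ M⁻¹.mulVec (hor x)) := by
  rw [EuclideanSpace.norm_eq]
  congr 1
  refine Finset.sum_congr rfl fun i _ => ?_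
  rw [Real.norm_eq_abs, sq_abs, sq]
  rfl

theorem IsWeakForm.norm_horCLM_le (hW : IsWeakForm A q M ρ) (p v : Heis n) :
    ‖horCLM M v‖ₑ ≤ ENNReal.ofReal (Real.sqrt (metric A p v v)) := by
  rw [← ofReal_norm, norm_horCLM, hW.metric_eq]
  refine ENNReal.ofReal_le_ofReal (Real.sqrt_le_sqrt (le_add_of_nonneg_right ?_))
  rw [mul_assoc]
  exact mul_nonneg (sq_nonneg _) (mul_self_nonneg _)

theorem IsWeakForm.enorm_horCLM_sub_lt (hW : IsWeakForm A q M ρ) {x y : Heis n} {b : ℝ≥0∞}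
    (h : edistA A x y < b) : ‖horCLM M y - horCLM M x‖ₑ < b := by
  let _ : ∀ p : Heis n, ENorm (TangentSpace 𝓘(ℝ, Heis n) p) :=
    fun p => ⟨fun v => ENNReal.ofReal (Real.sqrt (metric A p v v))⟩
  obtain ⟨γ, h0, h1, hγ, hlen⟩ := Manifold.exists_lt_of_riemannianEDist_lt h
  refine lt_of_le_of_lt ?_ hlen
  rw [contMDiffOn_iff_contDiffOn] at hγ
  rw [Manifold.pathELength_eq_lintegral_mfderivWithin_Icc, ← h0, ← h1]
  have hF : ContDiffOn ℝ 1 (fun t => horCLM M (γ t)) (Set.Icc 0 1) :=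
    (horCLM M).contDiff.comp_contDiffOn hγ
  refine (enorm_sub_le_lintegral_derivWithin_Icc_of_contDiffOn_Icc hF zero_le_one).trans ?_
  refine setLIntegral_mono' measurableSet_Icc fun t ht => ?_
  rw [mfderivWithin_eq_fderivWithin]
  have hd := (hγ.differentiableOn one_ne_zero t ht).hasFDerivWithinAt
  have hd' := ((horCLM M).hasFDerivAt.comp_hasFDerivWithinAt t hd).hasDerivWithinAt
  have := hd'.derivWithin (uniqueDiffOn_Icc zero_lt_one t ht)
  rw [show (fun t => horCLM M (γ t)) = horCLM M ∘ γ from rfl, this]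
  exact hW.norm_horCLM_le (γ t) _

/-- The balls of radius `2 D` around the points of `P(Γ_r)` cover `𝔳₀`. -/
theorem IsWeakForm.exists_close (hW : IsWeakForm A q M ρ) {r : Fin n → ℕ} {D : ℝ} (hD : 0 < D)
    (hdiam : diam A r ≤ ENNReal.ofReal D) (v : HorIdx n → ℝ) :
    ∃ l ∈ hor '' (lattice r : Set (Heis n)),
      M⁻¹.mulVec (v - l) ⬝ᵥ M⁻¹.mulVec (v - l) ≤ (2 * D) ^ 2 := by
  have h1 : quotEDist A r (Quotient.mk'' (1 : Heis n)) (Quotient.mk'' (ofHor v)) <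
      ENNReal.ofReal (2 * D) :=
    ((le_iSup₂ (f := fun p q => quotEDist A r p q) _ _).trans hdiam).trans_lt
      ((ENNReal.ofReal_lt_ofReal_iff (by linarith)).2 (by linarith))
  simp only [quotEDist, iInf_lt_iff] at h1
  obtain ⟨x, y, hx, hy, hxy⟩ := h1
  obtain ⟨⟨γ, hγ⟩, rfl⟩ := Quotient.exact hx
  obtain ⟨⟨γ', hγ'⟩, rfl⟩ := Quotient.exact hy
  refine ⟨_, ⟨γ * γ'⁻¹, mul_mem hγ (inv_mem hγ'), rfl⟩, ?_⟩
  have h2 := hW.enorm_horCLM_sub_lt hxy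
  rw [← map_sub, ← ofReal_norm, ENNReal.ofReal_lt_ofReal_iff (by linarith),
    norm_horCLM] at h2
  have h3 : hor (γ' * ofHor v - γ * 1) = v - hor (γ * γ'⁻¹) := by
    ext a
    change (γ' * ofHor v) (Sum.inl a) - (γ * 1) (Sum.inl a) = v a - (γ * γ'⁻¹) (Sum.inl a)
    rw [mul_inl, mul_inl, mul_inl, inv_apply, one_apply]
    change γ' (Sum.inl a) + v a - _ = _
    ring
  have h4 := ((Real.sqrt_lt' (by linarith)).1 h2).le
  rw [← h3]
  exact h4

end Heis

open scoped Pointwise in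
@[to_additive]
theorem MeasureTheory.IsFundamentalDomain.measure_le_of_cover {G α : Type*} [Group G] [MulAction G α]
    [MeasurableSpace α] {s : Set α} {μ : Measure α} [MeasurableConstSMul G α]
    [SMulInvariantMeasure G α μ] [Countable G] (h : IsFundamentalDomain G s μ) {t : Set α}
    (ht : ∀ x : α, ∃ g : G, g • x ∈ t) : μ s ≤ μ t := by
  rw [h.measure_eq_tsum t]
  refine (measure_mono fun x hx => ?_).trans (measure_iUnion_le fun g : G => g • t ∩ s)
  obtain ⟨g, hg⟩ := ht x
  exact Set.mem_iUnion.2 ⟨g⁻¹, Set.mem_inv_smul_set_iff.2 hg, hx⟩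

theorem Subgroup.countable_closure {G : Type*} [Group G] {s : Set G} (hs : s.Countable) :
    Countable (Subgroup.closure s) := by
  have := hs.to_subtype
  rw [FreeGroup.closure_eq_range]
  have : Countable (FreeGroup s) :=
    inferInstanceAs (Countable (Quot (FreeGroup.Red.Step (α := s))))
  exact (MonoidHom.rangeRestrict_surjective _).countable

namespace Heis

variable {n : ℕ}

/-! ### The lattice -/

/-- The lengths of the sides of a fundamental box of `P(Γ_r)`. -/
def side (r : Fin n → ℕ) : HorIdx n → ℝ := Sum.elim (fun i => (r i : ℝ)) (fun _ => 1)

theorem side_pos {r : Fin n → ℕ} (hr : ∀ i, 0 < r i) (a : HorIdx n) : 0 < side r a := by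
  rcases a with i | i
  · exact Nat.cast_pos.2 (hr i)
  · exact one_pos

theorem prod_side (r : Fin n → ℕ) : ∏ a, side r a = ∏ i, (r i : ℝ) := by
  simp [side, Fintype.prod_sum_type]

instance (r : Fin n → ℕ) : Countable (lattice r) :=
  Subgroup.countable_closure (((Set.countable_range _).union (Set.countable_range _)).union
    (Set.countable_singleton _))

/-- The projection `P` as a group homomorphism. -/
def horHom (n : ℕ) : Heis n →* Multiplicative (HorIdx n → ℝ) where
  toFun x := Multiplicative.ofAdd (hor x)
  map_one' := rfl
  map_mul' _ _ := rfl

/-- The central one-parameter subgroup. -/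
def center (n : ℕ) : Multiplicative ℝ →* Heis n where
  toFun t := Sum.elim (fun _ => 0) (fun _ => t.toAdd)
  map_one' := by
    funext a
    rcases a with a | a <;> rfl
  map_mul' s t := by
    funext a
    rcases a with a | a
    · exact (add_zero (0 : ℝ)).symm
    · refine Eq.trans ?_ (mul_inr (_ : Heis n) (_ : Heis n) a).symm
      rw [symp_eq]
      change s.toAdd + t.toAdd = s.toAdd + t.toAdd + 1 / 2 * ((0 : HorIdx n → ℝ) ⬝ᵥ _)
      simp

theorem hor_basisVec_mem (r : Fin n → ℕ) (a : HorIdx n) :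
    Multiplicative.ofAdd (side r a • Pi.single a (1 : ℝ) : HorIdx n → ℝ) ∈
      (lattice r).map (horHom n) := by
  have key : ∀ t : ℝ, horHom n (t • basisVec (Sum.inl a)) =
      Multiplicative.ofAdd (t • Pi.single a (1 : ℝ) : HorIdx n → ℝ) := fun t => by
    rw [← hor_basisVec_inl]; rfl
  rcases a with i | i
  · rw [← key]
    exact Subgroup.mem_map_of_mem _ (Subgroup.subset_closure (Or.inl (Or.inl ⟨i, rfl⟩)))
  · rw [← key]
    refine Subgroup.mem_map_of_mem _ (Subgroup.subset_closure (Or.inl (Or.inr ⟨i, ?_⟩)))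
    exact (one_smul ℝ _).symm

theorem exists_mem_lattice_hor (r : Fin n → ℕ) (k : HorIdx n → ℤ) :
    ∃ γ ∈ lattice r, ∀ a, γ (Sum.inl a) = k a * side r a := by
  have h : ∏ a, (Multiplicative.ofAdd (side r a • Pi.single a (1 : ℝ) : HorIdx n → ℝ)) ^ k a ∈
      (lattice r).map (horHom n) :=
    Subgroup.prod_mem _ fun a _ => Subgroup.zpow_mem _ (hor_basisVec_mem r a) _
  obtain ⟨γ, hγ, he⟩ := h
  refine ⟨γ, hγ, fun a => ?_⟩
  have h2 : hor γ = ∑ a, k a • (side r a • Pi.single a (1 : ℝ) : HorIdx n → ℝ) := by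
    have := congrArg Multiplicative.toAdd he
    rw [toAdd_prod] at this
    exact this
  refine (congrFun h2 a).trans ?_
  rw [Finset.sum_apply]
  simp [Pi.single_apply]

theorem center_mem_lattice (r : Fin n → ℕ) (k : ℤ) :
    center n (Multiplicative.ofAdd (k : ℝ)) ∈ lattice r := by
  have h1 : center n (Multiplicative.ofAdd 1) = basisVec (Sum.inr ()) := by
    funext a
    refine Eq.trans ?_ (Pi.single_apply (Sum.inr () : HeisIdx n) (1 : ℝ) a).symm
    rcases a with a | a
    · exact (if_neg (by simp)).symm
    · exact (if_pos rfl).symm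
  have h2 : Multiplicative.ofAdd (k : ℝ) = (Multiplicative.ofAdd (1 : ℝ)) ^ k := by
    rw [← ofAdd_zsmul]; simp
  rw [h2, map_zpow, h1]
  exact Subgroup.zpow_mem _ (Subgroup.subset_closure (Set.mem_union_right _ (Set.mem_singleton _))) _

theorem exists_mul_mem_box {r : Fin n → ℕ} (hr : ∀ i, 0 < r i) (x : Heis n) :
    ∃ γ ∈ lattice r, coord (γ * x) ∈
      Set.univ.pi fun a : HeisIdx n => Set.Ico 0 (Sum.elim (side r) (fun _ => 1) a) := by
  obtain ⟨γ, hγ, h⟩ := exists_mem_lattice_hor r fun a => -⌊x (Sum.inl a) / side r a⌋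
  set y := γ * x with hy
  refine ⟨center n (Multiplicative.ofAdd ((-⌊y (Sum.inr ())⌋ : ℤ) : ℝ)) * γ,
    mul_mem (center_mem_lattice r _) hγ, ?_⟩
  rw [mul_assoc, ← hy]
  rintro (a | a) -
  · change (center n (Multiplicative.ofAdd ((-⌊y (Sum.inr ())⌋ : ℤ) : ℝ)) * y) (Sum.inl a) ∈ _
    have hs := side_pos hr a
    have e : (center n (Multiplicative.ofAdd ((-⌊y (Sum.inr ())⌋ : ℤ) : ℝ)) * y) (Sum.inl a) =
        Int.fract (x (Sum.inl a) / side r a) * side r a := by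
      rw [mul_inl, hy, mul_inl, h, Int.fract]
      change 0 + _ = _
      push_cast
      field_simp
      ring
    rw [e]
    refine ⟨mul_nonneg (Int.fract_nonneg _) hs.le, ?_⟩
    have := mul_lt_mul_of_pos_right (Int.fract_lt_one (x (Sum.inl a) / side r a)) hs
    rwa [one_mul] at this
  · change (center n (Multiplicative.ofAdd ((-⌊y (Sum.inr ())⌋ : ℤ) : ℝ)) * y) (Sum.inr a) ∈ _
    have e : (center n (Multiplicative.ofAdd ((-⌊y (Sum.inr ())⌋ : ℤ) : ℝ)) * y) (Sum.inr a) =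
        Int.fract (y (Sum.inr ())) := by
      rw [mul_inr, symp_eq]
      change ((-⌊y (Sum.inr ())⌋ : ℤ) : ℝ) + y (Sum.inr ()) + 1 / 2 * ((0 : HorIdx n → ℝ) ⬝ᵥ _) = _
      rw [Int.fract, zero_dotProduct]
      push_cast
      ring
    rw [e]
    exact ⟨Int.fract_nonneg _, Int.fract_lt_one _⟩

/-! ### The volume of the quotient -/

instance : (volume : Measure (Heis n)).IsAddHaarMeasure :=
  inferInstanceAs (volume : Measure (HeisIdx n → ℝ)).IsAddHaarMeasure

/-- The linear part of the left translation by `γ`. -/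
def translationLin (γ : Heis n) : Heis n →L[ℝ] Heis n :=
  LinearMap.toContinuousLinearMap
    (Matrix.toLin' (shear ((1 / 2 : ℝ) • hor γ)) : (HeisIdx n → ℝ) →ₗ[ℝ] _)

theorem mul_eq_add (γ x : Heis n) : γ * x = γ + translationLin γ x := by
  change coord (γ * x) = coord γ + (shear ((1 / 2 : ℝ) • hor γ)).mulVec (coord x)
  funext a
  rw [Pi.add_apply]
  rcases a with a | c
  · rw [shear_mulVec_inl]; rfl
  · rw [shear_mulVec_inr, symp_smul_left]
    change (γ * x) (Sum.inr c) = γ (Sum.inr c) + _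
    rw [mul_inr]
    ring

theorem measurePreserving_mul_left (γ : Heis n) :
    MeasurePreserving (fun x : Heis n => γ * x) := by
  have h1 : (fun x : Heis n => γ * x) = (fun y => γ + y) ∘ translationLin γ :=
    funext fun x => mul_eq_add γ x
  have hdet : LinearMap.det (translationLin γ : Heis n →ₗ[ℝ] Heis n) = 1 := by
    refine Eq.trans (LinearMap.det_toLin' (shear ((1 / 2 : ℝ) • hor γ))) (det_shear _)
  rw [h1]
  refine (measurePreserving_add_left volume γ).comp ⟨(translationLin γ).continuous.measurable, ?_⟩
  have := Measure.map_linearMap_addHaar_eq_smul_addHaar (volume : Measure (Heis n))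
    (f := (translationLin γ : Heis n →ₗ[ℝ] Heis n)) (by rw [hdet]; exact one_ne_zero)
  rw [hdet] at this
  simpa using this

theorem riemMeasure_eq (A : Matrix (HeisIdx n) (HeisIdx n) ℝ) :
    riemMeasure A = ENNReal.ofReal |A.det|⁻¹ • (volume : Measure (Heis n)) := by
  rw [← withDensity_const, riemMeasure]
  congr 1
  funext x
  exact congrArg _ (sqrt_det_metricMatrix A x)

theorem vol_le (A : Matrix (HeisIdx n) (HeisIdx n) ℝ) {r : Fin n → ℕ} (hr : ∀ i, 0 < r i) :
    vol A r ≤ ENNReal.ofReal (|A.det|⁻¹ * ∏ i, (r i : ℝ)) := by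
  rw [vol, covolume]
  split_ifs with hfd
  swap
  · exact zero_le
  have : MeasurableConstSMul (lattice r) (Heis n) :=
    ⟨fun γ => (measurePreserving_mul_left (γ : Heis n)).measurable⟩
  have : SMulInvariantMeasure (lattice r) (Heis n) (riemMeasure A) := by
    rw [riemMeasure_eq]
    refine ⟨fun γ s hs => ?_⟩
    rw [Measure.smul_apply, Measure.smul_apply]
    congr 1
    exact (measurePreserving_mul_left (γ : Heis n)).measure_preimage hs.nullMeasurableSet
  refine (hfd.ExistsIsFundamentalDomain.choose_spec.measure_le_of_cover
    (t := coord ⁻¹' Set.univ.pi fun a : HeisIdx n =>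
      Set.Ico 0 (Sum.elim (side r) (fun _ => 1) a)) fun x => ?_).trans_eq ?_
  · obtain ⟨γ, hγ, h⟩ := exists_mul_mem_box hr x
    exact ⟨⟨γ, hγ⟩, h⟩
  · rw [riemMeasure_eq, Measure.smul_apply, smul_eq_mul,
      ENNReal.ofReal_mul (inv_nonneg.2 (abs_nonneg _))]
    congr 1
    refine (Real.volume_pi_Ico (a := fun _ => 0)).trans ?_
    rw [← prod_side, ← ENNReal.ofReal_prod_of_nonneg
      (by rintro (a | a) -; exacts [by simpa using (side_pos hr a).le, by simp])]
    simp [Fintype.prod_sum_type]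

/-! ### Covering `𝔳₀` -/

/-- A set whose image under `M` covers `𝔳₀` modulo `P(Γ_r)` is at least as large as a fundamental
domain. -/
theorem prod_le_of_cover {r : Fin n → ℕ} (hr : ∀ i, 0 < r i)
    (M : Matrix (HorIdx n) (HorIdx n) ℝ) (s : Set (HorIdx n → ℝ))
    (hs : ∀ v, ∃ l ∈ hor '' (lattice r : Set (Heis n)), ∃ w ∈ s, v - l = M.mulVec w) :
    ENNReal.ofReal (∏ i, (r i : ℝ)) ≤ ENNReal.ofReal |M.det| * volume s := by
  set b : Module.Basis (HorIdx n) ℝ (HorIdx n → ℝ) :=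
    (Pi.basisFun ℝ (HorIdx n)).isUnitSMul fun a => isUnit_iff_ne_zero.2 (side_pos hr a).ne' with hb
  have hba (a : HorIdx n) : b a = side r a • Pi.single a (1 : ℝ) := by
    rw [hb, Module.Basis.isUnitSMul_apply, Pi.basisFun_apply]
  set L : AddSubgroup (HorIdx n → ℝ) := (Submodule.span ℤ (Set.range b)).toAddSubgroup with hL
  have hsub : ∀ γ ∈ lattice r, hor γ ∈ L := by
    have : lattice r ≤ (AddSubgroup.toSubgroup L).comap (horHom n) := by
      refine (Subgroup.closure_le _).2 ?_
      rintro x ((⟨i, rfl⟩ | ⟨i, rfl⟩) | rfl)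
      · refine Submodule.subset_span (R := ℤ) ⟨Sum.inl i, ?_⟩
        rw [hba, ← hor_basisVec_inl]; rfl
      · refine Submodule.subset_span (R := ℤ) ⟨Sum.inr i, ?_⟩
        rw [hba, ← hor_basisVec_inl]; exact one_smul ℝ _
      · change hor (basisVec (Sum.inr ())) ∈ L
        rw [hor_basisVec_inr]
        exact zero_mem _
    exact this
  have hfd := ZSpan.isAddFundamentalDomain' b (volume : Measure (HorIdx n → ℝ))
  have : Countable L := inferInstanceAs (Countable (Submodule.span ℤ (Set.range b)))
  have hcov := hfd.measure_le_of_cover (t := M.mulVecLin '' s) fun v => by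
    obtain ⟨l, ⟨γ, hγ, rfl⟩, w, hw, h⟩ := hs v
    refine ⟨-⟨hor γ, hsub γ hγ⟩, w, hw, ?_⟩
    rw [Matrix.mulVecLin_apply, ← h]
    change _ = -hor γ + v
    abel
  rw [ZSpan.volume_fundamentalDomain, Measure.addHaar_image_linearMap,
    ← Matrix.toLin'_apply', LinearMap.det_toLin'] at hcov
  refine le_trans (ENNReal.ofReal_le_ofReal ?_) hcov
  have hdiag : Matrix.of b = Matrix.diagonal (side r) := by
    ext a c
    rw [Matrix.of_apply, hba, Matrix.diagonal_apply]
    by_cases h : a = c <;> simp [h, eq_comm]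
  rw [hdiag, Matrix.det_diagonal, prod_side]
  exact le_abs_self _

end Heis

/-- Every vector is the image of a multiple of a given coordinate vector under an orthogonal
matrix. -/
theorem Matrix.exists_orthogonal_mulVec_single {ι : Type*} [Fintype ι] [DecidableEq ι] (a : ι)
    {v : ι → ℝ} (hv : v ≠ 0) : ∃ R ∈ Matrix.orthogonalGroup ι ℝ,
      R.mulVec (Pi.single a (Real.sqrt (v ⬝ᵥ v))) = v := by
  set x : EuclideanSpace ℝ ι := WithLp.toLp 2 v with hx
  have hx0 : x ≠ 0 := fun h => hv (congrArg WithLp.ofLp h)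
  have hn : ‖x‖ ≠ 0 := norm_ne_zero_iff.2 hx0
  have hnorm : ‖x‖ = Real.sqrt (v ⬝ᵥ v) := by
    rw [EuclideanSpace.norm_eq]
    congr 1
    refine Finset.sum_congr rfl fun i _ => ?_
    rw [Real.norm_eq_abs, sq_abs, sq]
  obtain ⟨b, hb⟩ := Orthonormal.exists_orthonormalBasis_extension_of_card_eq (𝕜 := ℝ)
    (E := EuclideanSpace ℝ ι) (ι := ι) (by simp) (v := fun _ => ‖x‖⁻¹ • x) (s := {a}) (by
      refine ⟨fun i => ?_, fun i j hij => (hij (Subsingleton.elim i j)).elim⟩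
      simp [norm_smul, hn])
  refine ⟨Matrix.of fun i j => b j i, ?_, ?_⟩
  · rw [Matrix.mem_orthogonalGroup_iff']
    ext i j
    have := orthonormal_iff_ite.1 b.orthonormal i j
    rw [PiLp.inner_apply] at this
    rw [Matrix.one_apply, ← this, Matrix.mul_apply]
    refine Finset.sum_congr rfl fun k _ => ?_
    simp [mul_comm]
  · ext i
    rw [Matrix.mulVec_single, ← hnorm]
    simp only [Matrix.col_apply, Pi.smul_apply, MulOpposite.smul_eq_mul_unop,
      MulOpposite.unop_op, Matrix.of_apply, hb a rfl, PiLp.smul_apply, smul_eq_mul, hx]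
    rw [← hx]
    field_simp

namespace Heis

variable {n : ℕ}

theorem exists_weakCanonical {A : Matrix (HeisIdx n) (HeisIdx n) ℝ} (hA : IsUnit A.det) :
    ∃ (g : Heis n) (R : Matrix (HeisIdx n) (HeisIdx n) ℝ)
      (M : Matrix (HorIdx n) (HorIdx n) ℝ) (ρ : ℝ),
      R ∈ Matrix.orthogonalGroup (HeisIdx n) ℝ ∧ innMatrix g * A * R = weakCanonical M ρ := by
  set e : HeisIdx n → ℝ := Pi.single (Sum.inr ()) 1
  have hAe : A.mulVec (A⁻¹.mulVec e) = e := by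
    rw [Matrix.mulVec_mulVec, Matrix.mul_nonsing_inv _ hA, Matrix.one_mulVec]
  have hw : A⁻¹.mulVec e ≠ 0 := fun h => by
    rw [h, Matrix.mulVec_zero] at hAe
    have := congrFun hAe (Sum.inr ())
    simp [e] at this
  obtain ⟨R, hR, hRw⟩ := Matrix.exists_orthogonal_mulVec_single (Sum.inr ()) hw
  set t := Real.sqrt (A⁻¹.mulVec e ⬝ᵥ A⁻¹.mulVec e)
  have hcol : ∀ i : HorIdx n, (A * R) (Sum.inl i) (Sum.inr ()) = 0 := by
    have h1 : (A * R).mulVec (Pi.single (Sum.inr ()) t) = e := by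
      rw [← Matrix.mulVec_mulVec, hRw, hAe]
    have ht : t ≠ 0 := fun h => by
      rw [h, Pi.single_zero, Matrix.mulVec_zero] at hRw
      exact hw hRw.symm
    intro i
    have := congrFun h1 (Sum.inl i)
    rw [Matrix.mulVec_single] at this
    simpa [e, ht] using this
  have hblocks : A * R = Matrix.fromBlocks (A * R).toBlocks₁₁ 0 (A * R).toBlocks₂₁
      (A * R).toBlocks₂₂ := by
    conv_lhs => rw [← Matrix.fromBlocks_toBlocks (A * R)]
    congr 1
    ext i j
    exact hcol i
  set a := (A * R).toBlocks₁₁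
  set c := (A * R).toBlocks₂₁
  set d := (A * R).toBlocks₂₂
  have ha : IsUnit a.det := by
    have h1 : |(A * R).det| ≠ 0 := by
      rw [Matrix.det_mul, abs_mul, Matrix.abs_det_of_mem_orthogonalGroup hR, mul_one]
      exact abs_ne_zero.2 hA.ne_zero
    rw [hblocks, Matrix.det_fromBlocks_zero₁₂] at h1
    exact isUnit_iff_ne_zero.2 fun h => by simp [h] at h1
  set f : HorIdx n → ℝ := fun j => -(c * a⁻¹) () j
  set q : HorIdx n → ℝ := Matrix.vecMul f (sympMatrix n).transpose
  have hq : (Matrix.of fun (_ : Unit) b => symp q (Pi.single b 1)) = -(c * a⁻¹) := by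
    ext i j
    rw [Matrix.of_apply, symp_eq, Matrix.dotProduct_mulVec, Matrix.vecMul_vecMul,
      mul_eq_one_comm.1 sympMatrix_mul_transpose, Matrix.vecMul_one, dotProduct_single, mul_one]
    rfl
  refine ⟨ofHor q, R, a, d () (), hR, ?_⟩
  rw [innMatrix_eq, show hor (ofHor q) = q from rfl, Matrix.mul_assoc, hblocks, shear, hq,
    Matrix.fromBlocks_multiply, weakCanonical]
  simp only [Matrix.one_mul, Matrix.zero_mul, Matrix.mul_zero, add_zero, zero_add]
  rw [Matrix.neg_mul, Matrix.mul_assoc, Matrix.nonsing_inv_mul _ ha, Matrix.mul_one,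
    neg_add_cancel]
  rfl

theorem add_zsmul_mem_hor_lattice {r : Fin n → ℕ} {l U : HorIdx n → ℝ}
    (hl : l ∈ hor '' (lattice r : Set (Heis n))) (hU : U ∈ hor '' (lattice r : Set (Heis n)))
    (k : ℤ) : l + k • U ∈ hor '' (lattice r : Set (Heis n)) := by
  obtain ⟨γ, hγ, rfl⟩ := hl
  obtain ⟨η, hη, rfl⟩ := hU
  refine ⟨γ * η ^ k, mul_mem hγ (zpow_mem hη k), ?_⟩
  have := congrArg Multiplicative.toAdd (map_mul (horHom n) γ (η ^ k))
  rw [map_zpow] at this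
  exact this

variable {A : Matrix (HeisIdx n) (HeisIdx n) ℝ} {M : Matrix (HorIdx n) (HorIdx n) ℝ} {ρ : ℝ}
  {q : HorIdx n → ℝ} {r : Fin n → ℕ} {D : ℝ}

theorem abs_le_of_dotProduct_self_le {w : HorIdx n → ℝ} {b : ℝ} (hb : 0 ≤ b)
    (h : w ⬝ᵥ w ≤ b ^ 2) (a : HorIdx n) : |w a| ≤ b := by
  refine abs_le_of_sq_le_sq (le_trans ?_ h) hb
  rw [sq]
  exact Finset.single_le_sum (f := fun i => w i * w i) (fun i _ => mul_self_nonneg _)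
    (Finset.mem_univ a)

theorem IsWeakForm.prod_le_det (hW : IsWeakForm A q M ρ) (hr : ∀ i, 0 < r i) (hD : 0 < D)
    (hdiam : diam A r ≤ ENNReal.ofReal D) :
    ∏ i, (r i : ℝ) ≤ |M.det| * (4 * D) ^ (2 * n) := by
  have h := prod_le_of_cover hr M (Set.Icc (fun _ => -(2 * D)) fun _ => 2 * D) fun v => by
    obtain ⟨l, hl, h⟩ := hW.exists_close hD hdiam v
    have h2 := abs_le_of_dotProduct_self_le (by linarith) h
    refine ⟨l, hl, _, ⟨fun a => (abs_le.1 (h2 a)).1, fun a => (abs_le.1 (h2 a)).2⟩, ?_⟩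
    rw [Matrix.mulVec_mulVec, Matrix.mul_nonsing_inv _ hW.isUnit_det, Matrix.one_mulVec]
  rw [Real.volume_Icc_pi, ← ENNReal.ofReal_prod_of_nonneg (fun _ _ => by linarith),
    ← ENNReal.ofReal_mul (abs_nonneg _), ENNReal.ofReal_le_ofReal_iff
      (mul_nonneg (abs_nonneg _) (Finset.prod_nonneg fun _ _ => by linarith))] at h
  refine h.trans_eq ?_
  rw [Finset.prod_const, Finset.card_univ, Fintype.card_sum, Fintype.card_fin, ← two_mul]
  ring

theorem IsWeakForm.prod_le_norm (hW : IsWeakForm A q M ρ) (hn : 1 ≤ n) (hr : ∀ i, 0 < r i)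
    (hD : 0 < D) (hdiam : diam A r ≤ ENNReal.ofReal D) {U : HorIdx n → ℝ}
    (hU : U ∈ hor '' (lattice r : Set (Heis n))) (hU0 : U ≠ 0) :
    ∏ i, (r i : ℝ) ≤ |M.det| *
      (Real.sqrt (M⁻¹.mulVec U ⬝ᵥ M⁻¹.mulVec U) * (4 * D) ^ (2 * n - 1)) := by
  have hMM : M * M⁻¹ = 1 := Matrix.mul_nonsing_inv _ hW.isUnit_det
  have hU' : M⁻¹.mulVec U ≠ 0 := fun h => hU0 (by
    rw [← Matrix.one_mulVec U, ← hMM, ← Matrix.mulVec_mulVec, h, Matrix.mulVec_zero])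
  let a₀ : HorIdx n := Sum.inl ⟨0, hn⟩
  obtain ⟨O, hO, hOU⟩ := Matrix.exists_orthogonal_mulVec_single a₀ hU'
  set ℓ := Real.sqrt (M⁻¹.mulVec U ⬝ᵥ M⁻¹.mulVec U) with hℓ
  have hℓ0 : 0 < ℓ := by
    refine lt_of_le_of_ne (Real.sqrt_nonneg _) fun h => hU' ?_
    rw [← hOU, ← h, Pi.single_zero, Matrix.mulVec_zero]
  have hOO : O * O.transpose = 1 := (Matrix.mem_orthogonalGroup_iff _ _).1 hO
  have h := prod_le_of_cover hr (M * O) (Set.Icc (Function.update (fun _ => -(2 * D)) a₀ 0)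
    (Function.update (fun _ => 2 * D) a₀ ℓ)) fun v => by
    obtain ⟨l, hl, h⟩ := hW.exists_close hD hdiam v
    set w := M⁻¹.mulVec (v - l) with hw
    set c := O.transpose.mulVec w with hc
    have hcc : c ⬝ᵥ c ≤ (2 * D) ^ 2 := by
      rwa [hc, Matrix.dotProduct_mulVec, ← Matrix.mulVec_transpose, Matrix.transpose_transpose,
        Matrix.mulVec_mulVec, hOO, Matrix.one_mulVec]
    have h2 := abs_le_of_dotProduct_self_le (by linarith) hcc
    set k := ⌊c a₀ / ℓ⌋ with hk
    have hs0 : (c - Pi.single a₀ (k * ℓ) : HorIdx n → ℝ) a₀ = Int.fract (c a₀ / ℓ) * ℓ := by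
      rw [Pi.sub_apply, Pi.single_eq_same, Int.fract, ← hk]
      field_simp
    have hs (a : HorIdx n) (ha : a ≠ a₀) : (c - Pi.single a₀ (k * ℓ) : HorIdx n → ℝ) a = c a := by
      rw [Pi.sub_apply, Pi.single_eq_of_ne ha, sub_zero]
    refine ⟨l + k • U, add_zsmul_mem_hor_lattice hl hU k, c - Pi.single a₀ (k * ℓ),
      ⟨fun a => ?_, fun a => ?_⟩, ?_⟩
    · by_cases ha : a = a₀
      · subst ha
        rw [Function.update_self, hs0]
        exact mul_nonneg (Int.fract_nonneg _) hℓ0.le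
      · rw [Function.update_of_ne ha, hs a ha]
        exact (abs_le.1 (h2 a)).1
    · by_cases ha : a = a₀
      · subst ha
        rw [Function.update_self, hs0]
        exact mul_le_of_le_one_left hℓ0.le (Int.fract_lt_one _).le
      · rw [Function.update_of_ne ha, hs a ha]
        exact (abs_le.1 (h2 a)).2
    · have e1 : (Pi.single a₀ (k * ℓ) : HorIdx n → ℝ) = (k : ℝ) • Pi.single a₀ ℓ := by
        rw [← Pi.single_smul, smul_eq_mul]
      rw [Matrix.mulVec_sub, e1, Matrix.mulVec_smul, ← Matrix.mulVec_mulVec c,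
        ← Matrix.mulVec_mulVec _ M O, hOU, hc, Matrix.mulVec_mulVec w, hOO, Matrix.one_mulVec, hw,
        Matrix.mulVec_mulVec, Matrix.mulVec_mulVec, hMM, Matrix.one_mulVec, Matrix.one_mulVec,
        sub_add_eq_sub_sub, Int.cast_smul_eq_zsmul]
  have hvol : volume (Set.Icc (Function.update (fun _ : HorIdx n => -(2 * D)) a₀ 0)
      (Function.update (fun _ => 2 * D) a₀ ℓ)) = ENNReal.ofReal (ℓ * (4 * D) ^ (2 * n - 1)) := by
    rw [Real.volume_Icc_pi, ← Finset.mul_prod_erase _ _ (Finset.mem_univ a₀),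
      Function.update_self, Function.update_self, sub_zero, ENNReal.ofReal_mul hℓ0.le]
    congr 1
    rw [Finset.prod_congr rfl (g := fun _ => ENNReal.ofReal (4 * D)) fun a ha => by
      rw [Function.update_of_ne (Finset.ne_of_mem_erase ha),
        Function.update_of_ne (Finset.ne_of_mem_erase ha)]
      congr 1; ring]
    rw [Finset.prod_const, Finset.card_erase_of_mem (Finset.mem_univ _), Finset.card_univ,
      Fintype.card_sum, Fintype.card_fin, ← two_mul, ENNReal.ofReal_pow (by linarith)]
  rwa [hvol, Matrix.det_mul, abs_mul, Matrix.abs_det_of_mem_orthogonalGroup hO, mul_one,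
    ← ENNReal.ofReal_mul (abs_nonneg _), ENNReal.ofReal_le_ofReal_iff (by positivity)] at h

theorem IsWeakForm.boldtConditions (hW : IsWeakForm A q M ρ) (hA : IsUnit A.det) (hn : 1 ≤ n)
    (hr : ∀ i, 0 < r i) {V K : ℝ} (hD : 0 < D) (hV : 0 < V) (hK : 0 < K)
    (hdiam : diam A r ≤ ENNReal.ofReal D) (hvol : ENNReal.ofReal V ≤ vol A r)
    (hRic : RicciGe A K) {C₁ C₂ C₃ Cm Cp : ℝ}
    (hC₂ : C₂ = ((4 * n * D) ^ (2 * n))⁻¹) (hCp : Cp = (∏ i, (r i : ℝ)) * (V * C₂)⁻¹)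
    (hC₃ : C₃ = Real.sqrt (2 * K) * Cp) (hCm : Cm = C₂ ^ (1 / (n : ℝ)) / Real.sqrt (2 * K))
    (hC₁ : C₁ = (C₃ ^ n)⁻¹ * ((4 * n * D) ^ (2 * n - 1))⁻¹) :
    BoldtConditions r C₁ C₂ C₃ Cm Cp M ρ := by
  have hn' : (1 : ℝ) ≤ n := Nat.one_le_cast.2 hn
  have hnD : 4 * D ≤ 4 * n * D := by nlinarith
  have hP : 1 ≤ ∏ i, (r i : ℝ) := by
    rw [← Nat.cast_prod]
    exact_mod_cast Finset.prod_pos fun i _ => hr i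
  set p := ∏ i, (r i : ℝ)
  have hM : 0 < |M.det| := abs_pos.2 hW.isUnit_det.ne_zero
  have hρ : 0 < |ρ| := abs_pos.2 hW.ne_zero
  have hC₂0 : 0 < C₂ := by rw [hC₂]; positivity
  have hs : 0 < Real.sqrt (2 * K) := Real.sqrt_pos.2 (by linarith)
  have ha2 : C₂ ≤ |M.det| := by
    rw [hC₂]
    refine inv_le_of_inv_le₀ hM ?_
    rw [inv_le_iff_one_le_mul₀' hM]
    exact (hP.trans (hW.prod_le_det hr hD hdiam)).trans
      (mul_le_mul_of_nonneg_left (pow_le_pow_left₀ (by linarith) hnD _) hM.le)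
  have ha4 : |ρ| ≤ Cp := by
    have h1 := hvol.trans (vol_le A hr)
    rw [ENNReal.ofReal_le_ofReal_iff (by positivity), hW.abs_det] at h1
    have h2 : V * (|M.det| * |ρ|) ≤ p := by
      rwa [inv_mul_eq_div, le_div_iff₀ (by positivity)] at h1
    rw [hCp, ← div_eq_mul_inv, le_div_iff₀ (by positivity)]
    calc |ρ| * (V * C₂) ≤ |ρ| * (V * |M.det|) := by gcongr
      _ = V * (|M.det| * |ρ|) := by ring
      _ ≤ p := h2
  obtain ⟨d, hd, hprod, hbound⟩ := exists_isJSpectrum hW.isUnit_det hW.ne_zero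
  have hd0 := hd.1
  have hdk (k : Fin n) : d k ≤ Real.sqrt (2 * K) * |ρ| := by
    have h1 := hbound _ (hW.jMatrix_le hA hRic) k
    refine le_of_sq_le_sq ?_ (by positivity)
    rwa [mul_pow, Real.sq_sqrt (by linarith), sq_abs]
  have hdC (k : Fin n) : d k ≤ C₃ :=
    (hdk k).trans (hC₃ ▸ mul_le_mul_of_nonneg_left ha4 hs.le)
  have hC₃0 : 0 < C₃ := (hd0 ⟨0, hn⟩).trans_le (hdC _)
  refine ⟨fun U hU hU0 => ?_, ha2, ⟨d, hd, hdC⟩, ?_, ha4⟩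
  · rw [innerA_weakCanonical_ofHor hW.isUnit_det hW.ne_zero]
    have h1 := hP.trans (hW.prod_le_norm hn hr hD hdiam hU hU0)
    set ℓ := Real.sqrt (M⁻¹.mulVec U ⬝ᵥ M⁻¹.mulVec U)
    have hℓ : 0 ≤ ℓ := Real.sqrt_nonneg _
    have h2 : |M.det| ≤ C₃ ^ n := by
      rw [← hprod]
      refine (Finset.prod_le_prod (fun k _ => (hd0 k).le) fun k _ => hdC k).trans_eq ?_
      simp
    rw [hC₁, ← mul_inv, inv_le_iff_one_le_mul₀' (by positivity)]
    calc 1 ≤ |M.det| * (ℓ * (4 * D) ^ (2 * n - 1)) := h1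
      _ ≤ C₃ ^ n * (ℓ * (4 * n * D) ^ (2 * n - 1)) := by gcongr
      _ = C₃ ^ n * (4 * n * D) ^ (2 * n - 1) * ℓ := by ring
  · rw [hCm, div_le_iff₀ hs, mul_comm]
    have h1 : C₂ ≤ (Real.sqrt (2 * K) * |ρ|) ^ n := by
      refine (ha2.trans_eq hprod.symm).trans
        ((Finset.prod_le_prod (fun k _ => (hd0 k).le) fun k _ => hdk k).trans_eq ?_)
      simp
    rw [one_div, Real.rpow_inv_le_iff_of_pos hC₂0.le (by positivity) (by linarith),
      Real.rpow_natCast]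
    exact h1

end Heis

end

theorem proposition5p2 (n : ℕ) (hn : 1 ≤ n) (r : Fin n → ℕ) (hr : r ∈ Heis.divisorChains n)
    (D V K : ℝ) (hD : 0 < D) (hV : 0 < V) (hK : 0 < K) :
    ∃ C₁ C₂ C₃ Cm Cp : ℝ,
      (0 < C₁ ∧ 0 < C₂ ∧ 0 < C₃ ∧ 0 < Cm ∧ 0 < Cp) ∧
      (C₂ = ((4 * n * D) ^ (2 * n))⁻¹ ∧
        Cp = (∏ i, (r i : ℝ)) * (V * C₂)⁻¹ ∧
        C₃ = Real.sqrt (2 * K) * Cp ∧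
        Cm = C₂ ^ (1 / (n : ℝ)) / Real.sqrt (2 * K) ∧
        C₁ = (C₃ ^ n)⁻¹ * ((4 * n * D) ^ (2 * n - 1))⁻¹) ∧
      ∀ A : Matrix (HeisIdx n) (HeisIdx n) ℝ, IsUnit A.det →
        Heis.diam A r ≤ ENNReal.ofReal D →
        ENNReal.ofReal V ≤ Heis.vol A r →
        Heis.RicciGe A K →
        (∃ (g : Heis n) (R : Matrix (HeisIdx n) (HeisIdx n) ℝ)
            (At : Matrix (HorIdx n) (HorIdx n) ℝ) (ρ : ℝ),
          R ∈ Matrix.orthogonalGroup (HeisIdx n) ℝ ∧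
            Heis.innMatrix g * A * R = Heis.weakCanonical At ρ) ∧
        ∀ (g : Heis n) (R : Matrix (HeisIdx n) (HeisIdx n) ℝ)
            (At : Matrix (HorIdx n) (HorIdx n) ℝ) (ρ : ℝ),
          R ∈ Matrix.orthogonalGroup (HeisIdx n) ℝ →
            Heis.innMatrix g * A * R = Heis.weakCanonical At ρ →
              Heis.BoldtConditions r C₁ C₂ C₃ Cm Cp At ρ := by
  have hn' : (0 : ℝ) < n := Nat.cast_pos.2 hn
  have hp : 0 < ∏ i, (r i : ℝ) := Finset.prod_pos fun i _ => Nat.cast_pos.2 (hr.1 i)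
  have hs : 0 < Real.sqrt (2 * K) := Real.sqrt_pos.2 (by linarith)
  refine ⟨_, _, _, _, _, ⟨?_, ?_, ?_, ?_, ?_⟩, ⟨rfl, rfl, rfl, rfl, rfl⟩,
    fun A hA hdiam hvol hRic => ⟨Heis.exists_weakCanonical hA, fun g R At ρ hR h =>
      (Heis.isWeakForm hA hR h).boldtConditions hA hn hr.1 hD hV hK hdiam hvol hRic
        rfl rfl rfl rfl rfl⟩⟩ <;> positivity
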